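/- \textbf{Setting.} A layered network has a finite set of supernodes, distributed over layers $1,\dots,\lambda$, each with $n$ input ports $x^V_1,\dots,x^V_n$ and $n$ output ports $y^V_1,\dots,y^V_n$; links lead from output ports of layer $l$ to input ports of layer $l+1$. The source $S$ lies in layer $1$, and every layer has at most $N_{layer}$ supernodes, which are linearly ordered. Let $R\ge 0$ be an integer and $\mathbb F_q$ a finite field. For a supernode $T\ne S$, $mincut(S,T)$ is the minimum, over all sets $\Omega$ of supernodes with $S\in\Omega$, $T\notin\Omega$, of the rank over $\mathbb F_q$ of the $0$-$1$ incidence matrix $G_\Omega$ between the output ports in $\Omega$ and the input ports outside $\Omega$. Let $W$ be a set of $R$ ports of supernodes of one layer, not containing both input and output ports of the same supernode. Its virtual sink $T(W)$ is a new supernode obtained as follows. Output ports in $W$ are connected to $T(W)$. For each supernode $V$ with $p\ge 1$ input ports in $W$, the other input ports of $V$ are disconnected and $y^V_1,\dots,y^V_p$ are connected to $T(W)$. Each connected output port has its own input port of $T(W)$. $W$ is \emph{regular} if $mincut(S,T(W))=R$ in the network so modified. A code assigns coefficients $\beta_{(x_i^V,y_j^V)}\in\mathbb F_q$ and one virtual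 coefficient $k_y\in\mathbb F_q$ to each output port $y$. Coding vectors in $\mathbb F_q^R$ satisfy $\mathbf y^V_j=\sum_i\beta_{(x_i^V,y_j^V)}\mathbf x^V_i$; for $V\neq S$, $\mathbf x^V_i=\sum_{y}k_{y}\mathbf y$ over the output ports $y$ linked to $x^V_i$; and $\mathbf x^S_i$ is the $i$-th standard basis vector for $i\le R$ and $0$ for $i>R$. Symbols in $\mathbb F_q$ obey the same equations, with source inputs $u_1,\dots,u_R,0,\dots,0$. For a set $D$ of supernodes of layer $l$, let $Q_l(D)$ consist of the output ports of the supernodes in $D$ and the input ports of the other supernodes of layer $l$ (for $S$, only its $R$ upper input ports). The \emph{invariant} holds for a set $Q$ of ports if every regular $R$-subset of $Q$ has linearly independent coding vectors. \textbf{Theorem.} \begin{enumerate} \item Let $1\le l\le\lambda-1$. For every regular set $W'$ of $R$ input ports of layer $l+1$ there is a regular set $W$ of $R$ output ports of layer $l$ such that the $R\times R$ incidence matrix $G_{(W,W')}$ has full rank over $\mathbb F_q$. \item Let $q>2\binom{nN_{layer}}{R}$ and $1\le l\le\lambda-1$. If the invariant holds for the output ports of layer $l$ that have an outgoing link, with any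 given coding vectors, then coefficients $k_y$ can be chosen such that, simultaneously, every regular set of $R$ input ports of layer $l+1$ has linearly independent coding vectors $\mathbf x=\sum_y k_y\mathbf y$. \item Let $q>n\binom{nN_{layer}}{R}$, $1\le l\le\lambda$, let $D$ be a set of supernodes of layer $l$ and $V\notin D$ a supernode of layer $l$. If the invariant holds for $Q_l(D)$, with any given coding vectors, then the coefficients $\beta_{(x_i^V,y_j^V)}$ can be chosen such that, with the resulting $\mathbf y^V_j$, the invariant holds for $Q_l(D\cup\{V\})$. \item Let $q>\max(2,n)\binom{nN_{layer}}{R}$. Then there is a code whose coding vectors satisfy the invariant for $Q_l(D)$ for every layer $l$ and every initial segment $D$ of layer $l$, and with which every supernode $V\ne S$ with $mincut(S,V)\ge R$ can decode: there are $\epsilon_{r,i}\in\mathbb F_q$ such that for all source data $u\in\mathbb F_q^R$ the symbols $s_i$ received at $x_i^V$ satisfy $\sum_{i=1}^n\epsilon_{r,i}s_i=u_r$ for $1\le r\le R$. \end{enumerate} -/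

import Mathlib

open scoped BigOperators

/-- A (deterministic, ADT type) network: `V` is the set of supernodes, `I` and `O` are the sets of
input and output ports, and a link leads from an output port to an input port. -/
structure ADTNetwork (V I O : Type*) where
  /-- the supernode an input port belongs to -/
  inNode : I → V
  /-- the supernode an output port belongs to -/
  outNode : O → V
  /-- `link y x`: there is a link from the output port `y` to the input port `x` -/
  link : O → I → Prop

namespace ADTNetwork

variable {V I O : Type*}

open Classical in
/-- The 0-1 incidence matrix of the links, with entries in the field `F`. -/
noncomputable def incidence (F : Type*) [Field F] (G : ADTNetwork V I O) : Matrix O I F :=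
  Matrix.of fun y x => if G.link y x then 1 else 0

open Classical in
/-- The rank of the incidence matrix `G_Ω` of the bipartite graph formed by the output ports of the
supernodes in `Ω` and the input ports of the supernodes outside `Ω`. -/
noncomputable def cutRank (F : Type*) [Field F] [Fintype I] (G : ADTNetwork V I O)
    (Ω : Set V) : ℕ :=
  ((G.incidence F).submatrix
    (fun y : {y : O // G.outNode y ∈ Ω} => y.1)
    (fun x : {x : I // G.inNode x ∉ Ω} => x.1)).rank

/-- `mincut(S, T)`: the minimum of `rank G_Ω` over all cuts `Ω` with `S ∈ Ω` and `T ∉ Ω`.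
(For `T = S` there is no cut and the value is `⊤`.) -/
noncomputable def mincut (F : Type*) [Field F] [Fintype I] (G : ADTNetwork V I O)
    (S T : V) : ℕ∞ :=
  ⨅ Ω : {Ω : Set V // S ∈ Ω ∧ T ∉ Ω}, (G.cutRank F Ω.1 : ℕ∞)

end ADTNetwork

/-- `(v, i)` is the `i`-th input port of the supernode `v`, counted from the top. -/
abbrev InPort (V : Type*) (n : ℕ) : Type _ := V × Fin n

/-- `(v, j)` is the `j`-th output port of the supernode `v`, counted from the top. -/
abbrev OutPort (V : Type*) (n : ℕ) : Type _ := V × Fin n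

/-- A port: `Sum.inl` of an input port or `Sum.inr` of an output port. -/
abbrev Port (V : Type*) (n : ℕ) : Type _ := InPort V n ⊕ OutPort V n

/-- The supernode of a port. -/
def Port.node {V : Type*} {n : ℕ} (p : Port V n) : V := Sum.elim Prod.fst Prod.fst p

/-- A layered network with layers `1, …, depth`, in which each supernode has `n` input ports and
`n` output ports, the source is in layer 1, and all links lead from one layer to the next. -/
structure LayeredNetwork (V : Type*) (n : ℕ) where
  depth : ℕ
  layer : V → ℕ
  layer_pos : ∀ v, 1 ≤ layer v
  layer_le : ∀ v, layer v ≤ depth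
  source : V
  layer_source : layer source = 1
  link : OutPort V n → InPort V n → Prop
  layer_link : ∀ y x, link y x → layer x.1 = layer y.1 + 1

namespace LayeredNetwork

variable {V : Type*} {n : ℕ}

/-- The network itself, without its layers. -/
def toADT (N : LayeredNetwork V n) : ADTNetwork V (InPort V n) (OutPort V n) where
  inNode := Prod.fst
  outNode := Prod.fst
  link := N.link

open Classical in
/-- The output ports that are connected to the virtual sink `T(W)`: the output ports in `W`, and,
for each supernode with `p` input ports in `W`, its `p` upper output ports. -/
def tapped (W : Finset (Port V n)) : Set (OutPort V n) :=
  {y | Sum.inr y ∈ W ∨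
    (y.2 : ℕ) < (Finset.univ.filter fun i : Fin n => Sum.inl (y.1, i) ∈ W).card}

/-- The input ports that are disconnected in the presence of the virtual sink `T(W)`: those outside
`W` that belong to a supernode with at least one input port in `W`. -/
def disconnected (W : Finset (Port V n)) : Set (InPort V n) :=
  {x | Sum.inl x ∉ W ∧ ∃ i : Fin n, Sum.inl (x.1, i) ∈ W}

/-- The network with the virtual sink `T(W)`, which is the supernode `none`. The sink has one input
port for each tapped output port, and is linked to exactly that port by it. -/
def virtualSink (N : LayeredNetwork V n) (W : Finset (Port V n)) :
    ADTNetwork (Option V) (InPort V n ⊕ {y : OutPort V n // y ∈ tapped W}) (OutPort V n) where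
  inNode := Sum.elim (fun x => some x.1) (fun _ => none)
  outNode := fun y => some y.1
  link := fun y => Sum.elim (fun x => N.link y x ∧ x ∉ disconnected W) (fun z => y = z.1)

open Classical in
/-- A regular set: a set of `R` ports of supernodes of a single layer, not containing both input
and output ports of the same supernode, such that `mincut(S, T(W)) = R`. -/
structure IsRegular [Fintype V] (F : Type*) [Field F] (N : LayeredNetwork V n) (R : ℕ)
    (W : Finset (Port V n)) : Prop where
  card_eq : W.card = R
  same_layer : ∃ l, ∀ p ∈ W, N.layer p.node = l
  not_both : ∀ v i j, Sum.inl (v, i) ∈ W → Sum.inr (v, j) ∉ W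
  mincut_eq : (N.virtualSink W).mincut F (some N.source) none = (R : ℕ∞)

/-- The ports of layer `l` under consideration once the supernodes of the set `D` have had their
output ports coded: the output ports of the supernodes in `D` and the input ports of the others.
Only the `R` upper input ports of the source, which carry the data, take part. -/
def frontier (N : LayeredNetwork V n) (R l : ℕ) (D : Set V) : Set (Port V n) :=
  {p | N.layer p.node = l ∧
    Sum.elim (fun x : InPort V n => x.1 ∉ D ∧ (x.1 = N.source → (x.2 : ℕ) < R))
      (fun y : OutPort V n => y.1 ∈ D) p}

/-- The input ports of layer `l`. -/
def layerInputs (N : LayeredNetwork V n) (l : ℕ) : Set (Port V n) :=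
  {p | ∃ x : InPort V n, N.layer x.1 = l ∧ p = Sum.inl x}

/-- The output ports of layer `l` that have at least one outgoing link. -/
def linkedOutputs (N : LayeredNetwork V n) (l : ℕ) : Set (Port V n) :=
  {p | ∃ y : OutPort V n, N.layer y.1 = l ∧ (∃ x, N.link y x) ∧ p = Sum.inr y}

/-- The code invariant for the set of ports `Q`: every regular subset of `Q` of size `R` has
linearly independent coding vectors. Here `x` and `y` are the coding vectors of the input and of
the output ports. -/
def Invariant [Fintype V] {F : Type*} [Field F] (N : LayeredNetwork V n) (R : ℕ)
    (Q : Set (Port V n)) (x : InPort V n → Fin R → F) (y : OutPort V n → Fin R → F) : Prop :=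
  ∀ W : Finset (Port V n), (∀ p ∈ W, p ∈ Q) → N.IsRegular F R W →
    LinearIndependent F (fun p : {p : Port V n // p ∈ W} => Sum.elim x y p.1)

open Classical in
/-- What the input port `x` receives when each output port `y'` carries `k y' • y y'`: the sum over
all output ports that are linked to `x`. The coefficient depends on the output port only. -/
noncomputable def received [Fintype V] {F M : Type*} [Field F] [AddCommGroup M] [Module F M]
    (N : LayeredNetwork V n) (k : OutPort V n → F) (y : OutPort V n → M) (x : InPort V n) : M :=
  ∑ y' ∈ Finset.univ.filter (fun y' : OutPort V n => N.link y' x), k y' • y y'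

end LayeredNetwork

open Classical in
/-- The coding vectors of the output ports after the supernode `v` has been given the internal
coding coefficients `b i j`; those of the other supernodes are kept. -/
noncomputable def recode {V : Type*} {n : ℕ} {F M : Type*} [Field F] [AddCommGroup M] [Module F M]
    (v : V) (b : Fin n → Fin n → F) (x : InPort V n → M) (y : OutPort V n → M) :
    OutPort V n → M :=
  fun p => if p.1 = v then ∑ i, b i p.2 • x (v, i) else y p

/-- A linear network code: `β v i j` is the internal coefficient from the `i`-th input port to the
`j`-th output port of `v`, and `k y` is the virtual coding coefficient of the output port `y`. -/
structure LinearCode (V : Type*) (n : ℕ) (F : Type*) where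
  β : V → Fin n → Fin n → F
  k : OutPort V n → F

/-- The input of the source: `u` on the `R` upper input ports, and zero on the lower ones. -/
def sourceInput {M : Type*} [Zero M] (n : ℕ) {R : ℕ} (u : Fin R → M) : Fin n → M :=
  fun i => if h : (i : ℕ) < R then u ⟨i, h⟩ else 0

/-- `x` and `y` are the values on the input and output ports that result when the network uses the
code `c` and the source has the input `s`. The values lie in an `F`-module: in `F` itself for
symbols, and in `F^R` for coding vectors. -/
structure LinearCode.Transmits {V : Type*} [Fintype V] {n : ℕ} {F M : Type*} [Field F]
    [AddCommGroup M] [Module F M] (c : LinearCode V n F) (N : LayeredNetwork V n)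
    (s : Fin n → M) (x : InPort V n → M) (y : OutPort V n → M) : Prop where
  source_eq : ∀ i, x (N.source, i) = s i
  input_eq : ∀ v, v ≠ N.source → ∀ i, x (v, i) = N.received c.k y (v, i)
  output_eq : ∀ v j, y (v, j) = ∑ i, c.β v i j • x (v, i)

/-! Within one layer, regularity is independence in a matroid. Eliminating the virtual sink from its
cuts (`isRegular_iff`) shows that an unmixed set W of R ports of layer l is regular exactly when
`capacity` is at least R on W. This is the minimum, over cuts Ω containing the source, of two terms:
the rank of the links from output ports in Ω of earlier layers to input ports that lie behind Ω or
in W, and the number of ports of W that are outputs in Ω or inputs of the source. The rank of a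
submatrix is submodular jointly in rows and columns (`setRank_submodular`), and minimising over Ω
preserves this, so `capacity` is a matroid rank function (`isRankFun_capacity`).

Three facts follow. A regular set of inputs W' of layer l + 1 is fed by a regular set of outputs of
layer l: this is matroid intersection (`exists_common_independent`) of the row matroid of the
incidence matrix on the columns W' with the capacity matroid of layer l, where the min-max condition
comes from gluing cuts (`exists_regular_outputs`). The outputs of a supernode in a regular set can
be exchanged for equally many of its inputs, by basis extension (`exists_exchange`). A supernode
with mincut at least R has R input ports forming a regular set (`exists_regular_inputs`).

The first two facts serve one regular set at a time: letting only the feeding outputs transmit gives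
coding matrix Gᵀ·Y with both factors nonsingular, and forwarding the exchanged inputs to the outputs
copies independent vectors. All regular sets are served at once because each coefficient moves the
coding vectors along a single direction, a rank one perturbation. The determinants are therefore
affine in each coefficient (`exists_det_add_rank_one`), and fewer than q nonzero functions of this
kind have a common nonvanishing point over a field with q elements
(`exists_forall_ne_zero_of_multiAffine`). A layer contributes at most binom(n·Nlayer, R) regular
sets to each step.

The code alternates the two coding steps through the layers. Decoding works because R independent
vectors span F^R and every symbol is the pairing of its coding vector with the source data. -/

open Module

/-! ### Ranks of submatrices and their submodularity -/

/-- The rank of the submatrix of `M` with rows in `X` and columns in `Y`. -/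
noncomputable def setRank {F O I : Type*} [Field F] (M : Matrix O I F) (X : Set O) (Y : Set I) : ℕ :=
  finrank F ((Submodule.span F ((fun y => M y) '' X)).map
    (LinearMap.funLeft F F (Subtype.val : Y → I)))

section SetRank

variable {F O I : Type*} [Field F]

lemma setRank_eq_finrank_span (M : Matrix O I F) (X : Set O) (Y : Set I) :
    setRank M X Y =
      finrank F (Submodule.span F (Set.range fun (y : X) (x : Y) => M y.1 x.1)) := by
  rw [setRank, Submodule.map_span, Set.image_image]
  have : (fun x => (LinearMap.funLeft F F (Subtype.val : Y → I)) (M x)) '' X =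
      Set.range fun (y : X) (x : Y) => M y.1 x.1 := by
    rw [Set.image_eq_range]
    rfl
  rw [this]

lemma setRank_eq_rank [Finite O] (M : Matrix O I F) (X : Set O) (Y : Set I) [Fintype Y] :
    (M.submatrix (fun y : X => y.1) (fun x : Y => x.1)).rank = setRank M X Y := by
  rw [Matrix.rank_eq_finrank_span_row, setRank_eq_finrank_span]
  rfl

lemma setRank_mono [Finite I] (M : Matrix O I F) {X X' : Set O} {Y Y' : Set I} (hX : X ⊆ X')
    (hY : Y ⊆ Y') : setRank M X Y ≤ setRank M X' Y' := by
  have h : LinearMap.funLeft F F (Subtype.val : Y → I) =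
      (LinearMap.funLeft F F (Set.inclusion hY)).comp
        (LinearMap.funLeft F F (Subtype.val : Y' → I)) := by
    ext; rfl
  unfold setRank
  calc _ ≤ finrank F ((Submodule.span F ((fun y => M y) '' X')).map
        (LinearMap.funLeft F F (Subtype.val : Y → I))) :=
        Submodule.finrank_mono (Submodule.map_mono (Submodule.span_mono (Set.image_mono hX)))
    _ ≤ _ := by
        rw [h, Submodule.map_comp]
        exact Submodule.finrank_map_le _ _

lemma setRank_eq_zero (M : Matrix O I F) {X : Set O} {Y : Set I}
    (h : ∀ y ∈ X, ∀ x ∈ Y, M y x = 0) : setRank M X Y = 0 := by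
  have : (Submodule.span F ((fun y => M y) '' X)).map
      (LinearMap.funLeft F F (Subtype.val : Y → I)) = ⊥ := by
    rw [Submodule.map_span, Submodule.span_eq_bot]
    rintro _ ⟨_, ⟨y, hy, rfl⟩, rfl⟩
    ext x
    exact h y hy x x.2
  rw [setRank, this, finrank_bot]

lemma setRank_le_ncard_left [Finite O] (M : Matrix O I F) (X : Set O) (Y : Set I) :
    setRank M X Y ≤ X.ncard := by
  classical
  have : Fintype X := Fintype.ofFinite X
  rw [setRank, Submodule.map_span, Set.image_image, Set.image_eq_range]
  refine (finrank_range_le_card _).trans ?_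
  rw [← Nat.card_eq_fintype_card, Nat.card_coe_set_eq]

lemma setRank_le_ncard_right [Finite I] (M : Matrix O I F) (X : Set O) (Y : Set I) :
    setRank M X Y ≤ Y.ncard := by
  classical
  have : Fintype Y := Fintype.ofFinite Y
  refine (Submodule.finrank_le _).trans ?_
  rw [Module.finrank_fintype_fun_eq_card, ← Nat.card_eq_fintype_card, Nat.card_coe_set_eq]

/-- The kernel of the restriction to `Y` consists of the functions that vanish on `Y`. -/
lemma mem_ker_funLeft_subtype {Y : Set I} {v : I → F} :
    v ∈ LinearMap.ker (LinearMap.funLeft F F (Subtype.val : Y → I)) ↔ ∀ x ∈ Y, v x = 0 := by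
  rw [LinearMap.mem_ker]
  constructor
  · intro h x hx
    exact congrFun h ⟨x, hx⟩
  · intro h
    ext x
    exact h x x.2

/-- Rank-nullity for the restriction to `Y`, applied on the sum of the row span and the kernel. It
trades a rank that depends on two sets for dimensions inside one fixed space. -/
lemma setRank_add_finrank_ker [Finite I] (M : Matrix O I F) (X : Set O) (Y : Set I) :
    setRank M X Y + finrank F (LinearMap.ker (LinearMap.funLeft F F (Subtype.val : Y → I))) =
      finrank F ↥(Submodule.span F ((fun y => M y) '' X) ⊔
        LinearMap.ker (LinearMap.funLeft F F (Subtype.val : Y → I))) := by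
  set f := LinearMap.funLeft F F (Subtype.val : Y → I)
  set R := Submodule.span F ((fun y => M y) '' X)
  have h := LinearMap.finrank_range_add_finrank_ker (f.domRestrict (R ⊔ LinearMap.ker f))
  rw [← h, LinearMap.range_domRestrict, LinearMap.ker_domRestrict, Submodule.map_sup]
  have h1 : (LinearMap.ker f).map f = ⊥ := by
    rw [eq_bot_iff, Submodule.map_le_iff_le_comap]
    exact fun v hv => hv
  rw [h1, sup_bot_eq]
  congr 1
  exact (Submodule.comapSubtypeEquivOfLe (le_sup_right : LinearMap.ker f ≤ R ⊔ LinearMap.ker f)).finrank_eq.symm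

/-- With S the row span and K the functions vanishing on the columns, the rank is dim (S + K) - dim
K. The K-terms are modular, because unions and intersections of column sets become intersections and
sums of the K. The remaining terms are compared by the dimension formula for S₁ + K₁ and S₂ + K₂. -/
lemma setRank_submodular [Finite I] (M : Matrix O I F) (X₁ X₂ : Set O) (Y₁ Y₂ : Set I) :
    setRank M (X₁ ∪ X₂) (Y₁ ∩ Y₂) + setRank M (X₁ ∩ X₂) (Y₁ ∪ Y₂) ≤
      setRank M X₁ Y₁ + setRank M X₂ Y₂ := by
  classical
  let K : Set I → Submodule F (I → F) :=
    fun Y => LinearMap.ker (LinearMap.funLeft F F (Subtype.val : Y → I))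
  let S : Set O → Submodule F (I → F) := fun X => Submodule.span F ((fun y => M y) '' X)
  have hK : K (Y₁ ∪ Y₂) = K Y₁ ⊓ K Y₂ := by
    ext v
    simp only [K, Submodule.mem_inf, mem_ker_funLeft_subtype, Set.mem_union]
    exact ⟨fun h => ⟨fun x hx => h x (.inl hx), fun x hx => h x (.inr hx)⟩,
      fun h x hx => hx.elim (h.1 x) (h.2 x)⟩
  have hK' : K (Y₁ ∩ Y₂) = K Y₁ ⊔ K Y₂ := by
    ext v
    simp only [K, Submodule.mem_sup, mem_ker_funLeft_subtype]
    constructor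
    · intro h
      -- The part of `v` supported on `Y₁` vanishes on `Y₂`, since `v` vanishes on the intersection.
      refine ⟨fun x => if x ∈ Y₁ then 0 else v x, fun x hx => if_pos hx,
        fun x => if x ∈ Y₁ then v x else 0, ?_, ?_⟩
      · intro x hx
        by_cases hx1 : x ∈ Y₁
        · simpa [hx1] using h x ⟨hx1, hx⟩
        · simp [hx1]
      · ext x
        by_cases hx1 : x ∈ Y₁ <;> simp [hx1]
    · rintro ⟨a, ha, b, hb, rfl⟩ x ⟨h1, h2⟩
      simp [ha x h1, hb x h2]
  have hS : S (X₁ ∪ X₂) = S X₁ ⊔ S X₂ := by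
    simp only [S, Set.image_union, Submodule.span_union]
  have hS' : S (X₁ ∩ X₂) ≤ S X₁ ⊓ S X₂ :=
    le_inf (Submodule.span_mono (Set.image_mono Set.inter_subset_left))
      (Submodule.span_mono (Set.image_mono Set.inter_subset_right))
  have e1 : setRank M X₁ Y₁ + finrank F (K Y₁) = finrank F ↥(S X₁ ⊔ K Y₁) :=
    setRank_add_finrank_ker M X₁ Y₁
  have e2 : setRank M X₂ Y₂ + finrank F (K Y₂) = finrank F ↥(S X₂ ⊔ K Y₂) :=
    setRank_add_finrank_ker M X₂ Y₂
  have e3 : setRank M (X₁ ∪ X₂) (Y₁ ∩ Y₂) + finrank F (K (Y₁ ∩ Y₂)) =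
      finrank F ↥(S (X₁ ∪ X₂) ⊔ K (Y₁ ∩ Y₂)) := setRank_add_finrank_ker M _ _
  have e4 : setRank M (X₁ ∩ X₂) (Y₁ ∪ Y₂) + finrank F (K (Y₁ ∪ Y₂)) =
      finrank F ↥(S (X₁ ∩ X₂) ⊔ K (Y₁ ∪ Y₂)) := setRank_add_finrank_ker M _ _
  have d1 := Submodule.finrank_sup_add_finrank_inf_eq (K Y₁) (K Y₂)
  have d2 := Submodule.finrank_sup_add_finrank_inf_eq (S X₁ ⊔ K Y₁) (S X₂ ⊔ K Y₂)
  rw [← hK, ← hK'] at d1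
  have d3 : S X₁ ⊔ K Y₁ ⊔ (S X₂ ⊔ K Y₂) = S (X₁ ∪ X₂) ⊔ K (Y₁ ∩ Y₂) := by
    rw [hS, hK', sup_sup_sup_comm]
  rw [d3] at d2
  have d4 : finrank F ↥(S (X₁ ∩ X₂) ⊔ K (Y₁ ∪ Y₂)) ≤
      finrank F ↥((S X₁ ⊔ K Y₁) ⊓ (S X₂ ⊔ K Y₂)) := by
    apply Submodule.finrank_mono
    rw [hK]
    exact sup_le (hS'.trans (inf_le_inf le_sup_left le_sup_left))
      (inf_le_inf le_sup_right le_sup_right)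
  omega

lemma setRank_union_left_le [Finite I] (M : Matrix O I F) (X₁ X₂ : Set O) (Y : Set I) :
    setRank M (X₁ ∪ X₂) Y ≤ setRank M X₁ Y + setRank M X₂ Y := by
  have := setRank_submodular M X₁ X₂ Y Y
  rw [Set.inter_self] at this
  omega

lemma setRank_union_right_le [Finite I] (M : Matrix O I F) (X : Set O) (Y₁ Y₂ : Set I) :
    setRank M X (Y₁ ∪ Y₂) ≤ setRank M X Y₁ + setRank M X Y₂ := by
  have := setRank_submodular M X X Y₁ Y₂
  rw [Set.inter_self] at this
  omega

/-- Rows that vanish on the given columns may be dropped. -/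
lemma setRank_le_of_rows [Finite I] (M : Matrix O I F) {X X' : Set O} {Y : Set I}
    (h : ∀ y ∈ X, y ∉ X' → ∀ x ∈ Y, M y x = 0) : setRank M X Y ≤ setRank M X' Y := by
  have h1 := setRank_union_left_le M X' (X \ X') Y
  rw [setRank_eq_zero M (X := X \ X') fun y hy => h y hy.1 hy.2, Set.union_sdiff_self] at h1
  exact (setRank_mono M Set.subset_union_right subset_rfl).trans h1

/-- The rank of a block triangular matrix is at least the sum of the ranks of the diagonal
blocks. -/
lemma setRank_add_le_of_block [Finite I] (M : Matrix O I F) {X₁ X₂ : Set O} {Y₁ Y₂ : Set I}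
    (h : ∀ y ∈ X₁, ∀ x ∈ Y₂, M y x = 0) :
    setRank M X₁ Y₁ + setRank M X₂ Y₂ ≤ setRank M (X₁ ∪ X₂) (Y₁ ∪ Y₂) := by
  -- The zero block is one of the two submatrices on the larger side of submodularity; the smaller
  -- side contains both diagonal blocks.
  have h1 := setRank_submodular M (X₁ ∪ X₂) X₁ (Y₁ ∪ Y₂) Y₂
  rw [setRank_eq_zero M h] at h1
  have h2 : setRank M X₂ Y₂ ≤ setRank M (X₁ ∪ X₂ ∪ X₁) ((Y₁ ∪ Y₂) ∩ Y₂) :=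
    setRank_mono M (fun y hy => .inl (.inr hy)) fun x hx => ⟨.inr hx, hx⟩
  have h3 : setRank M X₁ Y₁ ≤ setRank M ((X₁ ∪ X₂) ∩ X₁) (Y₁ ∪ Y₂ ∪ Y₂) :=
    setRank_mono M (fun y hy => ⟨.inl hy, hy⟩) fun x hx => .inl (.inl hx)
  omega

/-- A submatrix that is a permutation matrix has full rank. -/
lemma le_setRank_of_matching [Finite O] (M : Matrix O I F) (X : Set O) (e : X → I)
    (h : ∀ y, M y.1 (e y) = 1) (h' : ∀ y y', y ≠ y' → M y.1 (e y') = 0) :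
    X.ncard ≤ setRank M X (Set.range e) := by
  classical
  have : Fintype X := Fintype.ofFinite X
  have hli : LinearIndependent F fun y : X => (fun x : ↥(Set.range e) => M y.1 x.1) := by
    rw [Fintype.linearIndependent_iff]
    intro g hg y
    have := congrFun hg ⟨e y, y, rfl⟩
    simp only [Finset.sum_apply, Pi.smul_apply, smul_eq_mul, Pi.zero_apply] at this
    rw [Finset.sum_eq_single y] at this
    · simpa [h y] using this
    · intro b _ hb
      rw [h' b y hb, mul_zero]
    · simp
  rw [setRank_eq_finrank_span, finrank_span_eq_card hli, ← Nat.card_eq_fintype_card,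
    Nat.card_coe_set_eq]

lemma setRank_image {I' : Type*} (M : Matrix O I F) (M' : Matrix O I' F) (X : Set O) (Y : Set I)
    {e : I → I'} (he : Function.Injective e) (h : ∀ y ∈ X, ∀ x ∈ Y, M' y (e x) = M y x) :
    setRank M' X (e '' Y) = setRank M X Y := by
  rw [setRank_eq_finrank_span, setRank_eq_finrank_span,
    ← LinearEquiv.finrank_map_eq (LinearEquiv.funCongrLeft F F (Equiv.Set.image e Y he)),
    Submodule.map_span, ← Set.range_comp]
  have : (LinearEquiv.funCongrLeft F F (Equiv.Set.image e Y he)).toLinearMap ∘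
      (fun (y : X) (x : ↥(e '' Y)) => M' y.1 x.1) = fun (y : X) (x : Y) => M y.1 x.1 := by
    ext y x
    exact h y.1 y.2 x.1 x.2
  exact congrArg (fun g => finrank F (Submodule.span F (Set.range g))) this

/-- Columns that vanish on the given rows may be dropped. -/
lemma setRank_le_of_cols [Finite I] (M : Matrix O I F) {X : Set O} {Y Y' : Set I}
    (h : ∀ x ∈ Y, x ∉ Y' → ∀ y ∈ X, M y x = 0) : setRank M X Y ≤ setRank M X Y' := by
  have h1 := setRank_union_right_le M X Y' (Y \ Y')
  rw [setRank_eq_zero M (Y := Y \ Y') fun y hy x hx => h x hx.1 hx.2 y hy,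
    Set.union_sdiff_self] at h1
  exact (setRank_mono M subset_rfl Set.subset_union_right).trans h1

end SetRank

/-! ### Matroid rank functions and matroid intersection -/

/-- A set function with the properties of the rank function of a matroid, up to an additive
constant. -/
structure IsRankFun {α : Type*} [DecidableEq α] (f : Finset α → ℕ) : Prop where
  mono : ∀ A e, f A ≤ f (insert e A)
  unit : ∀ A e, f (insert e A) ≤ f A + 1
  submod : ∀ A B, f (A ∪ B) + f (A ∩ B) ≤ f A + f B

namespace IsRankFun

variable {α : Type*} [DecidableEq α] {f g : Finset α → ℕ}

lemma le_union (hf : IsRankFun f) (A B : Finset α) : f A ≤ f (A ∪ B) := by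
  induction B using Finset.induction_on with
  | empty => simp
  | insert e B _ ih =>
    rw [Finset.union_insert]
    exact ih.trans (hf.mono _ _)

lemma monotone (hf : IsRankFun f) : Monotone f := fun A B h => by
  simpa [Finset.union_eq_right.2 h] using hf.le_union A B

/-- Contraction of `C`. Since the value at `∅` is not normalised to 0, nothing has to be subtracted.
-/
lemma union_left (hf : IsRankFun f) (C : Finset α) : IsRankFun fun A => f (C ∪ A) where
  mono A e := by rw [Finset.union_insert]; exact hf.mono _ _
  unit A e := by rw [Finset.union_insert]; exact hf.unit _ _
  submod A B := by
    have := hf.submod (C ∪ A) (C ∪ B)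
    rwa [← Finset.union_union_distrib_left, ← Finset.union_inter_distrib_left] at this

lemma union_le_of_forall (hf : IsRankFun f) {B E : Finset α}
    (h : ∀ e ∈ E, f (insert e B) ≤ f B) : f (B ∪ E) ≤ f B := by
  induction E using Finset.induction_on with
  | empty => simp
  | insert e E _ ih =>
    have h1 := ih fun x hx => h x (Finset.mem_insert_of_mem hx)
    have h2 := h e (Finset.mem_insert_self _ _)
    have h3 := hf.submod (B ∪ E) (insert e B)
    have h4 : f B ≤ f ((B ∪ E) ∩ insert e B) := hf.monotone
      (Finset.subset_inter Finset.subset_union_left (Finset.subset_insert _ _))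
    have h5 : B ∪ E ∪ insert e B = B ∪ insert e E := by
      ext x; simp only [Finset.mem_union, Finset.mem_insert]; tauto
    rw [h5] at h3
    omega

/-- Every set has a subset whose size and value are prescribed. -/
lemma exists_subset_card (hf : IsRankFun f) (E : Finset α) {k : ℕ} (hk : f ∅ ≤ k) (hE : k ≤ f E) :
    ∃ B ⊆ E, f B = k ∧ B.card + f ∅ = k := by
  induction k, hk using Nat.le_induction with
  | base => exact ⟨∅, Finset.empty_subset _, rfl, by simp⟩
  | succ k hk ih =>
    obtain ⟨B, hBE, hB, hc⟩ := ih (by omega)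
    -- If no element of `E` raises the value of `B`, then `E` itself has value `f B = k`, too small.
    by_contra hcon
    have : ∀ e ∈ E, f (insert e B) ≤ f B := by
      intro e he
      by_contra hlt
      have hu := hf.unit B e
      have heB : e ∉ B := fun h => hlt (by rw [Finset.insert_eq_of_mem h])
      refine hcon ⟨insert e B, Finset.insert_subset he hBE, by omega, ?_⟩
      rw [Finset.card_insert_of_notMem heB]
      omega
    have h1 := hf.union_le_of_forall this
    rw [Finset.union_eq_right.2 hBE] at h1
    omega

lemma insert_eq_of_loop (hf : IsRankFun f) {e : α} (he : f {e} ≤ f ∅) (A : Finset α) :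
    f (insert e A) ≤ f A := by
  have h1 := hf.submod A {e}
  have h2 : f ∅ ≤ f (A ∩ {e}) := hf.monotone (Finset.empty_subset _)
  rw [Finset.union_comm, ← Finset.insert_eq] at h1
  omega

/-- The matroid intersection theorem. -/
theorem exists_common_independent (E : Finset α) {k : ℕ} (hf : IsRankFun f) (hg : IsRankFun g)
    (h : ∀ A ⊆ E, k + f ∅ + g ∅ ≤ f A + g (E \ A)) :
    ∃ I ⊆ E, I.card = k ∧ k + f ∅ ≤ f I ∧ k + g ∅ ≤ g I := by
  induction E using Finset.induction_on generalizing f g k with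
  | empty =>
    have := h ∅ subset_rfl
    simp only [Finset.sdiff_empty] at this
    exact ⟨∅, subset_rfl, by simp; omega, by omega, by omega⟩
  | insert e E he ih =>
    by_cases hdel : ∀ A ⊆ E, k + f ∅ + g ∅ ≤ f A + g (E \ A)
    · obtain ⟨I, hI, h'⟩ := ih hf hg hdel
      exact ⟨I, hI.trans (Finset.subset_insert _ _), h'⟩
    -- Deleting `e` breaks the condition at some `U`, so `e` has to be used: it is contracted, and
    -- `U` serves for uncrossing.
    push Not at hdel
    obtain ⟨U, hU, hlt⟩ := hdel
    have heU : e ∉ U := fun hh => he (hU hh)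
    have hfU : f ∅ ≤ f U := hf.monotone (Finset.empty_subset _)
    have hgU : g ∅ ≤ g (E \ U) := hg.monotone (Finset.empty_subset _)
    -- Were `e` a loop of `f`, the set `insert e U` would violate the hypothesis on `insert e E`;
    -- for `g`, the set `U` would.
    have hfe : f {e} = f ∅ + 1 := by
      have h1 := hf.unit ∅ e
      rw [insert_empty_eq] at h1
      by_contra hne
      have h2 := hf.insert_eq_of_loop (e := e) (by omega) U
      have h3 := h (insert e U) (Finset.insert_subset_insert _ hU)
      have h4 : insert e E \ insert e U = E \ U := by
        ext x; simp only [Finset.mem_sdiff, Finset.mem_insert]; grind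
      rw [h4] at h3
      omega
    have hge : g {e} = g ∅ + 1 := by
      have h1 := hg.unit ∅ e
      rw [insert_empty_eq] at h1
      by_contra hne
      have h2 := hg.insert_eq_of_loop (e := e) (by omega) (E \ U)
      have h3 := h U (hU.trans (Finset.subset_insert _ _))
      have h4 : insert e E \ U = insert e (E \ U) := by
        ext x; simp only [Finset.mem_sdiff, Finset.mem_insert]; grind
      rw [h4] at h3
      omega
    obtain ⟨m, rfl⟩ : ∃ m, k = m + 1 := ⟨k - 1, by omega⟩
    -- Uncrossing: the hypothesis at `U ∩ A` and at `U ∪ {e} ∪ A` is added up and bounded by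
    -- submodularity of `f` and `g`. The deficit of at least one at `U` supplies the unit that makes
    -- up for lowering `k` by one while both base values rise by one.
    have hcon : ∀ A ⊆ E, m + f ({e} ∪ ∅) + g ({e} ∪ ∅) ≤ f ({e} ∪ A) + g ({e} ∪ (E \ A)) := by
      intro A hA
      rw [Finset.union_empty, hfe, hge]
      have h1 := h (U ∩ A) ((Finset.inter_subset_left.trans hU).trans (Finset.subset_insert _ _))
      have h2 := h (U ∪ ({e} ∪ A)) (by
        intro x
        have := @hU x
        have := @hA x
        simp only [Finset.mem_union, Finset.mem_insert, Finset.mem_singleton]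
        tauto)
      have h3 := hf.submod U ({e} ∪ A)
      have h4 := hg.submod (E \ U) ({e} ∪ (E \ A))
      have e1 : U ∩ ({e} ∪ A) = U ∩ A := by
        ext x; simp only [Finset.mem_inter, Finset.mem_union, Finset.mem_singleton]; grind
      have e2 : insert e E \ (U ∩ A) = E \ U ∪ ({e} ∪ (E \ A)) := by
        ext x
        simp only [Finset.mem_inter, Finset.mem_union, Finset.mem_singleton, Finset.mem_sdiff,
          Finset.mem_insert]
        grind
      have e3 : insert e E \ (U ∪ ({e} ∪ A)) = E \ U ∩ ({e} ∪ (E \ A)) := by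
        ext x
        simp only [Finset.mem_inter, Finset.mem_union, Finset.mem_singleton, Finset.mem_sdiff,
          Finset.mem_insert]
        grind
      rw [e1] at h3
      rw [e2] at h1
      rw [e3] at h2
      omega
    obtain ⟨I, hI, hcard, h1, h2⟩ := ih (hf.union_left {e}) (hg.union_left {e}) hcon
    rw [Finset.union_empty] at h1 h2
    refine ⟨insert e I, Finset.insert_subset_insert _ hI, ?_, ?_, ?_⟩
    · rw [Finset.card_insert_of_notMem fun hh => he (hI hh), hcard]
    · rw [Finset.insert_eq]; omega
    · rw [Finset.insert_eq]; omega

/-- Minimising a jointly submodular function over one of its arguments. -/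
lemma of_iInf {ι : Type*} [Nonempty ι] [Max ι] [Min ι] {χ : ι → Finset α → ℕ}
    (mono : ∀ i A e, χ i A ≤ χ i (insert e A)) (unit : ∀ i A e, χ i (insert e A) ≤ χ i A + 1)
    (submod : ∀ i j A B, χ (i ⊓ j) (A ∪ B) + χ (i ⊔ j) (A ∩ B) ≤ χ i A + χ j B) :
    IsRankFun fun A => ⨅ i, χ i A := by
  have hle : ∀ i A, ⨅ i, χ i A ≤ χ i A := fun i A => ciInf_le (OrderBot.bddBelow _) i
  have hex : ∀ A, ∃ i, χ i A = ⨅ i, χ i A := fun A => ciInf_mem _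
  refine ⟨fun A e => le_ciInf fun i => (hle i A).trans (mono i A e), fun A e => ?_,
    fun A B => ?_⟩
  · obtain ⟨i, hi⟩ := hex A
    simp only [← hi]
    exact (hle i _).trans (unit i A e)
  · obtain ⟨i, hi⟩ := hex A
    obtain ⟨j, hj⟩ := hex B
    simp only [← hi, ← hj]
    exact (add_le_add (hle _ _) (hle _ _)).trans (submod i j A B)

end IsRankFun

/-! ### Cuts of a layer and the capacity function -/

namespace LayeredNetwork

variable {V : Type*} {n : ℕ}

lemma incidence_eq_zero (F : Type*) [Field F] (N : LayeredNetwork V n) {y : OutPort V n}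
    {x : InPort V n} (h : N.layer x.1 ≠ N.layer y.1 + 1) : N.toADT.incidence F y x = 0 := by
  simp only [ADTNetwork.incidence, Matrix.of_apply]
  exact if_neg fun hl => h (N.layer_link y x hl)

/-- The ports that are counted when `Ω` cuts a set of ports off: the output ports of `Ω` and the
input ports of the source. -/
def cutPorts (N : LayeredNetwork V n) (Ω : Set V) : Set (Port V n) :=
  {p | Sum.elim (fun x : InPort V n => x.1 = N.source) (fun y : OutPort V n => y.1 ∈ Ω) p}

/-- The input ports up to layer `l` that are behind the cut `Ω` or in `W`. -/
def cutInputs (N : LayeredNetwork V n) (l : ℕ) (Ω : Set V) (W : Finset (Port V n)) :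
    Set (InPort V n) :=
  {x | N.layer x.1 ≤ l ∧ (x.1 ∉ Ω ∨ Sum.inl x ∈ W ∧ x.1 ≠ N.source)}

/-- The output ports in `Ω` of the layers before layer `l`. -/
def cutOutputs (N : LayeredNetwork V n) (l : ℕ) (Ω : Set V) : Set (OutPort V n) :=
  {y | y.1 ∈ Ω ∧ N.layer y.1 < l}

open Classical in
/-- The value of the cut `Ω` for a set `W` of ports of layer `l`. -/
noncomputable def layerCut (F : Type*) [Field F] (N : LayeredNetwork V n) (l : ℕ) (Ω : Set V)
    (W : Finset (Port V n)) : ℕ :=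
  setRank (N.toADT.incidence F) (N.cutOutputs l Ω) (N.cutInputs l Ω W) +
    (W.filter fun p => p ∈ N.cutPorts Ω).card

/-- The minimum of the cuts for a set of ports of layer `l`. -/
noncomputable def capacity (F : Type*) [Field F] (N : LayeredNetwork V n) (l : ℕ)
    (W : Finset (Port V n)) : ℕ :=
  ⨅ Ω : Set V, N.layerCut F l (insert N.source Ω) W

/-- The infimum runs over all of `Set V`, with the source inserted, so that its index type is a
lattice as `IsRankFun.of_iInf` requires. This lemma returns to the cuts that contain the source. -/
lemma le_capacity_iff {F : Type*} [Field F] {N : LayeredNetwork V n} {l k : ℕ}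
    {W : Finset (Port V n)} :
    k ≤ N.capacity F l W ↔ ∀ Ω : Set V, N.source ∈ Ω → k ≤ N.layerCut F l Ω W := by
  constructor
  · intro h Ω hΩ
    rw [← Set.insert_eq_of_mem hΩ]
    exact h.trans (ciInf_le (OrderBot.bddBelow _) Ω)
  · exact fun h => le_ciInf fun Ω => h _ (Set.mem_insert _ _)

lemma exists_layerCut_eq (F : Type*) [Field F] (N : LayeredNetwork V n) (l : ℕ)
    (W : Finset (Port V n)) :
    ∃ Ω : Set V, N.source ∈ Ω ∧ N.layerCut F l Ω W = N.capacity F l W := by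
  obtain ⟨Ω, h⟩ := ciInf_mem fun Ω : Set V => N.layerCut F l (insert N.source Ω) W
  exact ⟨_, Set.mem_insert _ _, h⟩

lemma capacity_empty (F : Type*) [Field F] (N : LayeredNetwork V n) (l : ℕ) :
    N.capacity F l ∅ = 0 := by
  have h : N.layerCut F l Set.univ ∅ = 0 := by
    have h0 := setRank_eq_zero (N.toADT.incidence F) (X := N.cutOutputs l Set.univ)
      (Y := N.cutInputs l Set.univ ∅) (by rintro y - x ⟨-, h | h⟩ <;> simp at h)
    simp [layerCut, h0]
  have := le_capacity_iff.1 (le_refl (N.capacity F l ∅)) Set.univ (Set.mem_univ _)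
  omega

lemma card_filter_insert_le {α : Type*} [DecidableEq α] (p : α → Prop) [DecidablePred p]
    (A : Finset α) (e : α) :
    ((insert e A).filter p).card ≤ (A.filter p).card + if p e then 1 else 0 := by
  rw [Finset.filter_insert]
  split_ifs
  · exact Finset.card_insert_le _ _
  · exact le_rfl

variable [Fintype V]

/-- The cut value is jointly submodular when the order of the cuts is reversed: enlarging `W` and
shrinking `Ω` both enlarge the set of columns, so `A ∪ B` is paired with `Ω₁ ∩ Ω₂`. The unit
increase holds because a port is charged in only one of the two terms: an input port away from the
source adds a column, every other port can only add to the count. -/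
lemma isRankFun_capacity [DecidableEq V] (F : Type*) [Field F] (N : LayeredNetwork V n) (l : ℕ) :
    IsRankFun (N.capacity F l) := by
  classical
  refine IsRankFun.of_iInf (fun Ω A e => ?_) (fun Ω A e => ?_) fun Ω₁ Ω₂ A B => ?_
  · refine add_le_add (setRank_mono _ subset_rfl ?_) (Finset.card_le_card
      (Finset.filter_subset_filter _ (Finset.subset_insert _ _)))
    rintro x ⟨h, h'⟩
    exact ⟨h, h'.imp_right fun hx => ⟨Finset.mem_insert_of_mem hx.1, hx.2⟩⟩
  · unfold layerCut
    have h1 := card_filter_insert_le (fun p => p ∈ N.cutPorts (insert N.source Ω)) A e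
    by_cases hx : ∃ x : InPort V n, e = Sum.inl x ∧ x.1 ≠ N.source
    · obtain ⟨x, rfl, hx⟩ := hx
      rw [if_neg (by exact hx)] at h1
      have h2 : setRank (N.toADT.incidence F) (N.cutOutputs l (insert N.source Ω))
          (N.cutInputs l (insert N.source Ω) (insert (Sum.inl x) A)) ≤
          setRank (N.toADT.incidence F) (N.cutOutputs l (insert N.source Ω))
          (N.cutInputs l (insert N.source Ω) A ∪ {x}) := by
        refine setRank_mono _ subset_rfl ?_
        rintro z ⟨hz, h⟩
        by_cases hzx : z = x
        · exact .inr hzx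
        · refine .inl ⟨hz, h.imp_right fun h => ⟨?_, h.2⟩⟩
          exact (Finset.mem_insert.1 h.1).resolve_left fun h => hzx (Sum.inl_injective h)
      have h3 := setRank_union_right_le (N.toADT.incidence F)
        (N.cutOutputs l (insert N.source Ω)) (N.cutInputs l (insert N.source Ω) A) {x}
      have h4 := setRank_le_ncard_right (N.toADT.incidence F)
        (N.cutOutputs l (insert N.source Ω)) {x}
      rw [Set.ncard_singleton] at h4
      omega
    · have h2 : N.cutInputs l (insert N.source Ω) (insert e A) =
          N.cutInputs l (insert N.source Ω) A := by
        ext z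
        simp only [cutInputs, Set.mem_ofPred_eq, Finset.mem_insert]
        grind
      rw [h2]
      split_ifs at h1 <;> omega
  · unfold layerCut
    have h1 := setRank_submodular (N.toADT.incidence F)
      (N.cutOutputs l (insert N.source Ω₁)) (N.cutOutputs l (insert N.source Ω₂))
      (N.cutInputs l (insert N.source Ω₁) A) (N.cutInputs l (insert N.source Ω₂) B)
    have h2 : setRank (N.toADT.incidence F) (N.cutOutputs l (insert N.source (Ω₁ ⊔ Ω₂)))
        (N.cutInputs l (insert N.source (Ω₁ ⊔ Ω₂)) (A ∩ B)) ≤ _ :=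
      setRank_mono (N.toADT.incidence F)
        (X' := N.cutOutputs l (insert N.source Ω₁) ∪ N.cutOutputs l (insert N.source Ω₂))
        (Y' := N.cutInputs l (insert N.source Ω₁) A ∩ N.cutInputs l (insert N.source Ω₂) B)
        (by
          intro y
          simp only [cutOutputs, Set.mem_ofPred_eq, Set.mem_insert_iff, Set.mem_union,
            Set.sup_eq_union]
          tauto)
        (by
          intro x
          simp only [cutInputs, Set.mem_ofPred_eq, Set.mem_insert_iff, Set.mem_union,
            Set.sup_eq_union, Set.mem_inter_iff, Finset.mem_inter]
          tauto)
    have h3 : setRank (N.toADT.incidence F) (N.cutOutputs l (insert N.source (Ω₁ ⊓ Ω₂)))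
        (N.cutInputs l (insert N.source (Ω₁ ⊓ Ω₂)) (A ∪ B)) ≤ _ :=
      setRank_mono (N.toADT.incidence F)
        (X' := N.cutOutputs l (insert N.source Ω₁) ∩ N.cutOutputs l (insert N.source Ω₂))
        (Y' := N.cutInputs l (insert N.source Ω₁) A ∪ N.cutInputs l (insert N.source Ω₂) B)
        (by
          intro y
          simp only [cutOutputs, Set.mem_ofPred_eq, Set.mem_insert_iff, Set.mem_inter_iff,
            Set.inf_eq_inter]
          tauto)
        (by
          intro x
          simp only [cutInputs, Set.mem_ofPred_eq, Set.mem_insert_iff, Set.mem_union,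
            Set.inf_eq_inter, Set.mem_inter_iff, Finset.mem_union]
          tauto)
    set P := A.filter fun p => p ∈ N.cutPorts (insert N.source Ω₁)
    set Q := B.filter fun p => p ∈ N.cutPorts (insert N.source Ω₂)
    set P' := (A ∪ B).filter fun p => p ∈ N.cutPorts (insert N.source (Ω₁ ⊓ Ω₂))
    set Q' := (A ∩ B).filter fun p => p ∈ N.cutPorts (insert N.source (Ω₁ ⊔ Ω₂))
    have h4 : P' ∪ Q' ⊆ P ∪ Q := by
      rintro (x | y)
      all_goals
        simp only [P, Q, P', Q', cutPorts, Finset.mem_union, Finset.mem_filter, Finset.mem_inter,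
          Set.mem_ofPred_eq, Sum.elim_inl, Sum.elim_inr, Set.mem_insert_iff, Set.sup_eq_union,
          Set.inf_eq_inter, Set.mem_union, Set.mem_inter_iff]
        tauto
    have h5 : P' ∩ Q' ⊆ P ∩ Q := by
      rintro (x | y)
      all_goals
        simp only [P, Q, P', Q', cutPorts, Finset.mem_union, Finset.mem_filter, Finset.mem_inter,
          Set.mem_ofPred_eq, Sum.elim_inl, Sum.elim_inr, Set.mem_insert_iff, Set.sup_eq_union,
          Set.inf_eq_inter, Set.mem_union, Set.mem_inter_iff]
        tauto
    have h6 := Finset.card_union_add_card_inter P Q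
    have h7 := Finset.card_union_add_card_inter P' Q'
    have h8 := Finset.card_le_card h4
    have h9 := Finset.card_le_card h5
    omega

end LayeredNetwork

/-! ### Eliminating the virtual sink -/

namespace LayeredNetwork

variable {V : Type*} {n : ℕ}

/-- The ports of the supernodes in `Ω`. -/
def nodePorts (n : ℕ) (Ω : Set V) : Set (Port V n) :=
  {p | p.node ∈ Ω}

section Tapped

variable {W : Finset (Port V n)}

open Classical in
lemma layer_of_mem_tapped {N : LayeredNetwork V n} {l : ℕ} (hl : ∀ p ∈ W, N.layer p.node = l)
    {y : OutPort V n} (hy : y ∈ tapped W) : N.layer y.1 = l := by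
  rcases hy with hy | hy
  · exact hl _ hy
  · obtain ⟨i, hi⟩ := Finset.card_pos.1 ((Nat.zero_le _).trans_lt hy)
    exact hl _ (Finset.mem_filter.1 hi).2

open Classical in
lemma card_filter_node_eq (v : V) :
    (W.filter fun p => p.node = v).card =
      (Finset.univ.filter fun i : Fin n => Sum.inl (v, i) ∈ W).card +
      (Finset.univ.filter fun j : Fin n => Sum.inr (v, j) ∈ W).card := by
  have hinl : Function.Injective fun i : Fin n => (Sum.inl (v, i) : Port V n) := fun i j h => by
    simpa using h
  have hinr : Function.Injective fun i : Fin n => (Sum.inr (v, i) : Port V n) := fun i j h => by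
    simpa using h
  rw [← Finset.card_image_of_injective _ hinl, ← Finset.card_image_of_injective _ hinr,
    ← Finset.card_union_of_disjoint]
  · congr 1
    ext p
    rw [Finset.mem_filter, Finset.mem_union, Finset.mem_image, Finset.mem_image]
    constructor
    · rcases p with ⟨u, i⟩ | ⟨u, i⟩
      · rintro ⟨h, rfl⟩
        exact .inl ⟨i, Finset.mem_filter.2 ⟨Finset.mem_univ _, h⟩, rfl⟩
      · rintro ⟨h, rfl⟩
        exact .inr ⟨i, Finset.mem_filter.2 ⟨Finset.mem_univ _, h⟩, rfl⟩
    · rintro (⟨i, h, rfl⟩ | ⟨i, h, rfl⟩) <;> exact ⟨(Finset.mem_filter.1 h).2, rfl⟩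
  · rw [Finset.disjoint_left]
    intro p hp hp'
    obtain ⟨i, -, rfl⟩ := Finset.mem_image.1 hp
    obtain ⟨j, -, h⟩ := Finset.mem_image.1 hp'
    cases h

-- As no supernode has both kinds of ports in `W`, the taps at `v` are either its outputs in `W` or
-- its `p` upper outputs standing in for `p ≤ n` inputs. Either way the sink gets as many links from
-- `v` as `W` has ports there.
open Classical in
lemma card_tapped_node [Fintype V] (hnb : ∀ v i j, Sum.inl (v, i) ∈ W → Sum.inr (v, j) ∉ W) (v : V) :
    (Finset.univ.filter fun y : OutPort V n => y ∈ tapped W ∧ y.1 = v).card =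
      (W.filter fun p => p.node = v).card := by
  have hinj : Function.Injective fun i : Fin n => ((v, i) : OutPort V n) := fun i j h => by
    simpa using h
  set p := (Finset.univ.filter fun i : Fin n => Sum.inl (v, i) ∈ W).card with hp
  have h1 : (Finset.univ.filter fun y : OutPort V n => y ∈ tapped W ∧ y.1 = v) =
      (Finset.univ.filter fun j : Fin n => Sum.inr (v, j) ∈ W ∨ (j : ℕ) < p).image
        fun i => (v, i) := by
    ext ⟨u, j⟩
    simp only [Finset.mem_filter, Finset.mem_univ, true_and, Finset.mem_image, Prod.mk.injEq]
    constructor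
    · rintro ⟨h, rfl⟩; exact ⟨j, h, rfl, rfl⟩
    · rintro ⟨j, h, rfl, rfl⟩; exact ⟨h, rfl⟩
  rw [card_filter_node_eq, h1, Finset.card_image_of_injective _ hinj]
  rcases Nat.eq_zero_or_pos p with h0 | h0
  · rw [← hp, h0, zero_add]
    simp
  · obtain ⟨i, hi⟩ := Finset.card_pos.1 h0
    have hno : ∀ j, Sum.inr (v, j) ∉ W := fun j => hnb v i j (Finset.mem_filter.1 hi).2
    have hpn : p ≤ n := (Finset.card_filter_le _ _).trans (by simp)
    simp only [hno, false_or, Finset.filter_false, Finset.card_empty, add_zero, ← hp]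
    rw [Fin.card_filter_val_lt]
    omega

open Classical in
lemma ncard_tapped [Fintype V] (hnb : ∀ v i j, Sum.inl (v, i) ∈ W → Sum.inr (v, j) ∉ W)
    (Ω : Set V) :
    {y | y ∈ tapped W ∧ y.1 ∈ Ω}.ncard = (W.filter fun p => p ∈ nodePorts n Ω).card := by
  have h1 : {y | y ∈ tapped W ∧ y.1 ∈ Ω}.ncard =
      (Finset.univ.filter fun y : OutPort V n => y ∈ tapped W ∧ y.1 ∈ Ω).card := by
    rw [← Set.ncard_coe_finset]
    congr 1
    ext y; simp
  rw [h1, Finset.card_eq_sum_card_fiberwise (f := Prod.fst) (t := Finset.univ) (by simp),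
    Finset.card_eq_sum_card_fiberwise (f := Port.node) (t := Finset.univ) (by simp)]
  refine Finset.sum_congr rfl fun v _ => ?_
  by_cases hv : v ∈ Ω
  · have e1 : ((Finset.univ.filter fun y : OutPort V n => y ∈ tapped W ∧ y.1 ∈ Ω).filter
        fun y => y.1 = v) = Finset.univ.filter fun y : OutPort V n => y ∈ tapped W ∧ y.1 = v := by
      ext y; simp only [Finset.mem_filter, Finset.mem_univ, true_and]; grind
    have e2 : ((W.filter fun p => p ∈ nodePorts n Ω).filter fun p => p.node = v) =
        W.filter fun p => p.node = v := by
      ext y; simp only [Finset.mem_filter, nodePorts, Set.mem_ofPred_eq]; grind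
    rw [e1, e2, card_tapped_node hnb]
  · rw [Finset.filter_eq_empty_iff.2, Finset.filter_eq_empty_iff.2]
    · simp
    · rintro p hp rfl; exact hv (Finset.mem_filter.1 hp).2
    · rintro p hp rfl; exact hv (Finset.mem_filter.1 hp).2.2

end Tapped

variable {F : Type*} [Field F]

lemma incidence_virtualSink_inl (N : LayeredNetwork V n) (W : Finset (Port V n))
    (y : OutPort V n) (x : InPort V n) (hx : x ∉ disconnected W) :
    (N.virtualSink W).incidence F y (Sum.inl x) = N.toADT.incidence F y x := by
  have : (N.virtualSink W).link y (Sum.inl x) ↔ N.toADT.link y x := and_iff_left hx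
  simp only [ADTNetwork.incidence, Matrix.of_apply]
  by_cases h : N.toADT.link y x
  · rw [if_pos h, if_pos (this.2 h)]
  · rw [if_neg h, if_neg fun hh => h (this.1 hh)]

lemma incidence_virtualSink_inl_eq_zero (N : LayeredNetwork V n) (W : Finset (Port V n))
    (y : OutPort V n) (x : InPort V n) (hx : x ∈ disconnected W) :
    (N.virtualSink W).incidence F y (Sum.inl x) = 0 := by
  simp only [ADTNetwork.incidence, virtualSink, Matrix.of_apply, Sum.elim_inl]
  exact if_neg fun h => h.2 hx

open Classical in
lemma incidence_virtualSink_inr (N : LayeredNetwork V n) (W : Finset (Port V n))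
    (y : OutPort V n) (z : {y : OutPort V n // y ∈ tapped W}) :
    (N.virtualSink W).incidence F y (Sum.inr z) = if y = z.1 then 1 else 0 := by
  have : (N.virtualSink W).link y (Sum.inr z) ↔ y = z.1 := Iff.rfl
  simp only [ADTNetwork.incidence, Matrix.of_apply, this]

variable [Fintype V]

/-- The cuts of a virtual sink in terms of the ranks of the original network. -/
lemma cutRank_virtualSink (N : LayeredNetwork V n) (W : Finset (Port V n)) (Ω' : Set (Option V))
    [Fintype (InPort V n ⊕ {y : OutPort V n // y ∈ tapped W})] :
    (N.virtualSink W).cutRank F Ω' = setRank ((N.virtualSink W).incidence F)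
      {y | some y.1 ∈ Ω'} {z | (N.virtualSink W).inNode z ∉ Ω'} := by
  classical
  unfold ADTNetwork.cutRank
  have : Fintype ↑{z | (N.virtualSink W).inNode z ∉ Ω'} := Fintype.ofFinite _
  rw [← setRank_eq_rank]
  congr!

open Classical in
/-- The value of the cut `Ω` for the virtual sink of a set `W` of ports of layer `l`. -/
noncomputable def sinkCut (F : Type*) [Field F] (N : LayeredNetwork V n) (l : ℕ) (Ω : Set V)
    (W : Finset (Port V n)) : ℕ :=
  setRank (N.toADT.incidence F) (N.cutOutputs l Ω)
      {x | N.layer x.1 ≤ l ∧ x.1 ∉ Ω ∧ x ∉ disconnected W} +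
    (W.filter fun p => p ∈ nodePorts n Ω).card

/-- On the columns of the sink, only the rows of tapped output ports are nonzero. -/
lemma setRank_virtualSink_range_inr_le (N : LayeredNetwork V n) {W : Finset (Port V n)}
    (hnb : ∀ v i j, Sum.inl (v, i) ∈ W → Sum.inr (v, j) ∉ W) (Ω : Set V) :
    open Classical in
    setRank ((N.virtualSink W).incidence F) {y | y.1 ∈ Ω} (Set.range Sum.inr) ≤
      (W.filter fun p => p ∈ nodePorts n Ω).card := by
  classical
  rw [← ncard_tapped hnb]
  refine (setRank_le_of_rows _ (X' := {y | y ∈ tapped W ∧ y.1 ∈ Ω}) ?_).trans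
    (setRank_le_ncard_left _ _ _)
  rintro y hy hy' _ ⟨z, rfl⟩
  rw [incidence_virtualSink_inr, if_neg]
  rintro rfl
  exact hy' ⟨z.2, hy⟩

/-- Layers after `l` play no role for the sink, and the sink's own columns contribute exactly the
number of taps on the source side of the cut. -/
lemma le_cutRank_iff_le_sinkCut (N : LayeredNetwork V n) {W : Finset (Port V n)} {l R : ℕ}
    (hl : ∀ p ∈ W, N.layer p.node = l)
    (hnb : ∀ v i j, Sum.inl (v, i) ∈ W → Sum.inr (v, j) ∉ W)
    [Fintype (InPort V n ⊕ {y : OutPort V n // y ∈ tapped W})] :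
    (∀ Ω' : Set (Option V), some N.source ∈ Ω' → none ∉ Ω' →
      R ≤ (N.virtualSink W).cutRank F Ω') ↔
      ∀ Ω : Set V, N.source ∈ Ω → R ≤ N.sinkCut F l Ω W := by
  classical
  constructor
  · intro h Ω hΩ
    -- Placing all later layers on the source side leaves only the inputs up to layer `l` and the
    -- sink's ports behind the cut.
    have h1 := h (some '' (Ω ∪ {v | l < N.layer v})) ⟨_, .inl hΩ, rfl⟩ (by simp)
    rw [cutRank_virtualSink] at h1
    set Y : Set (InPort V n) := {x | N.layer x.1 ≤ l ∧ x.1 ∉ Ω ∧ x ∉ disconnected W}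
    set M := (N.virtualSink W).incidence F
    have hX : {y : OutPort V n | some y.1 ∈ some '' (Ω ∪ {v | l < N.layer v})} =
        {y | y.1 ∈ Ω ∪ {v | l < N.layer v}} := by
      ext y; simp
    rw [hX] at h1
    have h2 : setRank M {y | y.1 ∈ Ω ∪ {v | l < N.layer v}}
        {z | (N.virtualSink W).inNode z ∉ some '' (Ω ∪ {v | l < N.layer v})} ≤
        setRank M {y | y.1 ∈ Ω ∪ {v | l < N.layer v}} (Sum.inl '' Y ∪ Set.range Sum.inr) := by
      apply setRank_le_of_cols
      rintro (x | z) hz hz' y hy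
      · apply incidence_virtualSink_inl_eq_zero
        by_contra hd
        apply hz'
        refine .inl ⟨x, ⟨?_, ?_, hd⟩, rfl⟩
        · by_contra hlt
          exact hz ⟨x.1, .inr (not_le.1 hlt), rfl⟩
        · exact fun hx => hz ⟨x.1, .inl hx, rfl⟩
      · exact absurd (.inr ⟨z, rfl⟩) hz'
    have h3 := setRank_union_right_le M {y | y.1 ∈ Ω ∪ {v | l < N.layer v}}
      (Sum.inl '' Y) (Set.range Sum.inr)
    have h4 := setRank_virtualSink_range_inr_le (F := F) N hnb (Ω ∪ {v | l < N.layer v})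
    have h5 : (W.filter fun p => p ∈ nodePorts n (Ω ∪ {v | l < N.layer v})) =
        W.filter fun p => p ∈ nodePorts n Ω := by
      apply Finset.filter_congr
      intro p hp
      have := hl p hp
      simp only [nodePorts, Set.mem_union, Set.mem_ofPred_eq, this, lt_irrefl, or_false]
    have h6 : setRank M {y | y.1 ∈ Ω ∪ {v | l < N.layer v}} (Sum.inl '' Y) ≤
        setRank (N.toADT.incidence F) (N.cutOutputs l Ω) Y := by
      rw [setRank_image (N.toADT.incidence F) M _ Y Sum.inl_injective fun y _ x hx =>
        incidence_virtualSink_inl N W y x hx.2.2]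
      apply setRank_le_of_rows
      intro y hy hy' x hx
      apply incidence_eq_zero
      intro heq
      have hxl := hx.1
      apply hy'
      refine ⟨hy.resolve_right fun h : l < N.layer y.1 => ?_, ?_⟩ <;> omega
    change R ≤ setRank _ _ Y + _
    rw [h5] at h4
    change setRank M _ _ ≤ _ at h4
    omega
  · intro h Ω' hS hT
    rw [cutRank_virtualSink]
    have h1 := h {v | some v ∈ Ω'} hS
    set Ω : Set V := {v | some v ∈ Ω'}
    set M := (N.virtualSink W).incidence F
    set Y : Set (InPort V n) := {x | N.layer x.1 ≤ l ∧ x.1 ∉ Ω ∧ x ∉ disconnected W}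
    set T : Set (OutPort V n) := {y | y ∈ tapped W ∧ y.1 ∈ Ω}
    have h2 : setRank M (N.cutOutputs l Ω) (Sum.inl '' Y) =
        setRank (N.toADT.incidence F) (N.cutOutputs l Ω) Y :=
      setRank_image _ M _ Y Sum.inl_injective fun y _ x hx =>
        incidence_virtualSink_inl N W y x hx.2.2
    let e : T → InPort V n ⊕ {y : OutPort V n // y ∈ tapped W} := fun y => Sum.inr ⟨y.1, y.2.1⟩
    have h3 : T.ncard ≤ setRank M T (Set.range e) := by
      apply le_setRank_of_matching
      · intro y
        exact (incidence_virtualSink_inr N W y.1 _).trans (if_pos rfl)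
      · intro y y' hne
        exact (incidence_virtualSink_inr N W y.1 _).trans
          (if_neg fun hh => hne (Subtype.ext hh))
    -- Tapped ports lie in layer `l`, so outputs of earlier layers vanish on the sink's columns: the
    -- matrix is block triangular, with a permutation matrix as one diagonal block.
    have h4 : setRank M (N.cutOutputs l Ω) (Sum.inl '' Y) + setRank M T (Set.range e) ≤
        setRank M (N.cutOutputs l Ω ∪ T) (Sum.inl '' Y ∪ Set.range e) := by
      apply setRank_add_le_of_block
      rintro y hy _ ⟨z, rfl⟩
      refine (incidence_virtualSink_inr N W y _).trans (if_neg ?_)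
      rintro rfl
      have h5 := layer_of_mem_tapped hl z.2.1
      have h6 := hy.2
      dsimp only at h6
      omega
    have h5 : setRank M (N.cutOutputs l Ω ∪ T) (Sum.inl '' Y ∪ Set.range e) ≤
        setRank M {y | some y.1 ∈ Ω'} {z | (N.virtualSink W).inNode z ∉ Ω'} := by
      apply setRank_mono
      · rintro y (hy | hy)
        · exact hy.1
        · exact hy.2
      · rintro _ (⟨x, hx, rfl⟩ | ⟨z, rfl⟩)
        · exact hx.2.1
        · exact hT
    change R ≤ setRank _ _ Y + _ at h1
    rw [← ncard_tapped hnb] at h1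
    change R ≤ _ + T.ncard at h1
    omega

/-- The two cut values differ at individual cuts but have the same lower bounds: in each direction,
the supernodes with inputs in `W` are moved to the side where one value dominates the other. In this
way disconnected ports disappear and input ports of `W` act as columns of their own. -/
lemma le_sinkCut_iff_le_layerCut (N : LayeredNetwork V n) {W : Finset (Port V n)} {l R : ℕ}
    (hl : ∀ p ∈ W, N.layer p.node = l)
    (hnb : ∀ v i j, Sum.inl (v, i) ∈ W → Sum.inr (v, j) ∉ W) :
    (∀ Ω : Set V, N.source ∈ Ω → R ≤ N.sinkCut F l Ω W) ↔
      ∀ Ω : Set V, N.source ∈ Ω → R ≤ N.layerCut F l Ω W := by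
  classical
  constructor
  · intro h Ω hΩ
    -- Supernodes other than the source with inputs in `W` go behind the cut. Their inputs outside
    -- `W` are disconnected, so just the columns in `W` are added.
    refine (h {v | v ∈ Ω ∧ (v = N.source ∨ ∀ i, Sum.inl (v, i) ∉ W)} ⟨hΩ, .inl rfl⟩).trans
      (add_le_add (setRank_mono _ ?_ ?_) (Finset.card_le_card ?_))
    · rintro y ⟨hy, hy'⟩
      exact ⟨hy.1, hy'⟩
    · rintro x ⟨hx, hx', hd⟩
      refine ⟨hx, ?_⟩
      by_cases hxΩ : x.1 ∈ Ω
      · right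
        by_contra hcon
        apply hx'
        refine ⟨hxΩ, ?_⟩
        by_contra hcon'
        push Not at hcon'
        obtain ⟨h1, i, hi⟩ := hcon'
        exact hd ⟨fun hh => hcon ⟨hh, h1⟩, i, hi⟩
      · exact .inl hxΩ
    · rintro (x | y) hp
      · obtain ⟨h1, h2, h3⟩ := Finset.mem_filter.1 hp
        exact Finset.mem_filter.2 ⟨h1, h3.resolve_right fun h => h x.2 h1⟩
      · obtain ⟨h1, h2, h3⟩ := Finset.mem_filter.1 hp
        exact Finset.mem_filter.2 ⟨h1, h2⟩
  · intro h Ω hΩ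
    -- Now these supernodes join the source side. Their inputs in `W` that were already in `Ω` cost
    -- at most one column each, which the taps of `sinkCut` pay for.
    have h1 := h {v | v ∈ Ω ∨ ∃ i, Sum.inl (v, i) ∈ W} (.inl hΩ)
    set Ω₂ : Set V := {v | v ∈ Ω ∨ ∃ i, Sum.inl (v, i) ∈ W}
    set Y : Set (InPort V n) := {x | N.layer x.1 ≤ l ∧ x.1 ∉ Ω ∧ x ∉ disconnected W}
    let Z : Set (InPort V n) := {x | Sum.inl x ∈ W ∧ x.1 ∈ Ω ∧ x.1 ≠ N.source}
    have h2 : setRank (N.toADT.incidence F) (N.cutOutputs l Ω₂) (N.cutInputs l Ω₂ W) ≤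
        setRank (N.toADT.incidence F) (N.cutOutputs l Ω) (Y ∪ Z) := by
      apply setRank_mono
      · rintro y ⟨hy | ⟨i, hi⟩, hy'⟩
        · exact ⟨hy, hy'⟩
        · have := hl _ hi
          simp only [Port.node, Sum.elim_inl] at this
          omega
      · rintro x ⟨hx, hx'⟩
        by_cases hxW : Sum.inl x ∈ W
        · by_cases hxΩ : x.1 ∈ Ω
          · refine .inr ⟨hxW, hxΩ, ?_⟩
            rcases hx' with h | h
            · exact absurd (.inl hxΩ) h
            · exact h.2
          · exact .inl ⟨hx, hxΩ, fun hd => hd.1 hxW⟩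
        · have hx2 : x.1 ∉ Ω₂ := hx'.resolve_right fun h => hxW h.1
          exact .inl ⟨hx, fun h => hx2 (.inl h), fun hd => hx2 (.inr hd.2)⟩
    have h3 := setRank_union_right_le (N.toADT.incidence F) (N.cutOutputs l Ω) Y Z
    have h4 := setRank_le_ncard_right (N.toADT.incidence F) (N.cutOutputs l Ω) Z
    have h5 : Z.ncard + (W.filter fun p => p ∈ N.cutPorts Ω₂).card ≤
        (W.filter fun p => p ∈ nodePorts n Ω).card := by
      rw [← Set.ncard_image_of_injective Z (Sum.inl_injective (β := OutPort V n)),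
        ← Set.ncard_coe_finset, ← Set.ncard_coe_finset, ← Set.ncard_union_eq]
      · apply Set.ncard_le_ncard _ (Finset.finite_toSet _)
        · rintro _ (⟨x, hx, rfl⟩ | hp)
          · exact Finset.mem_coe.2 (Finset.mem_filter.2 ⟨hx.1, hx.2.1⟩)
          · rename_i p
            obtain ⟨h6, h7⟩ := Finset.mem_filter.1 (Finset.mem_coe.1 hp)
            refine Finset.mem_coe.2 (Finset.mem_filter.2 ⟨h6, ?_⟩)
            rcases p with x | y
            · change x.1 = N.source at h7
              change x.1 ∈ Ω
              rwa [h7]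
            · rcases h7 with h7 | ⟨i, hi⟩
              · exact h7
              · exact absurd h6 (hnb _ i _ hi)
      · rw [Set.disjoint_left]
        rintro _ ⟨x, hx, rfl⟩ hp
        exact hx.2.2 (Finset.mem_filter.1 (Finset.mem_coe.1 hp)).2
    unfold layerCut at h1
    change R ≤ setRank _ _ Y + _
    omega

/-- Regularity in terms of the rank function of a layer. -/
theorem isRegular_iff (N : LayeredNetwork V n) {W : Finset (Port V n)} {l R : ℕ}
    (hl : ∀ p ∈ W, N.layer p.node = l)
    (hnb : ∀ v i j, Sum.inl (v, i) ∈ W → Sum.inr (v, j) ∉ W) :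
    N.IsRegular F R W ↔ W.card = R ∧ R ≤ N.capacity F l W := by
  classical
  rw [le_capacity_iff, ← le_sinkCut_iff_le_layerCut N hl hnb]
  constructor
  · intro h
    refine ⟨h.card_eq, ?_⟩
    rw [← le_cutRank_iff_le_sinkCut N hl hnb]
    intro Ω' hS hT
    have h1 := h.mincut_eq.ge
    unfold ADTNetwork.mincut at h1
    have := le_iInf_iff.1 h1 ⟨Ω', hS, hT⟩
    exact_mod_cast this
  · rintro ⟨hc, h⟩
    refine ⟨hc, ⟨l, hl⟩, hnb, le_antisymm ?_ ?_⟩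
    · unfold ADTNetwork.mincut
      -- The cut with only the sink behind it has rank at most the number of taps, which is `R`.
      refine (iInf_le _ ⟨Set.range some, ⟨_, rfl⟩, by simp⟩).trans ?_
      rw [Nat.cast_le, cutRank_virtualSink]
      refine (setRank_mono _ (X' := {y | y.1 ∈ (Set.univ : Set V)}) (Y' := Set.range Sum.inr)
        ?_ ?_).trans ((setRank_virtualSink_range_inr_le N hnb Set.univ).trans ?_)
      · intro y _
        exact Set.mem_univ _
      · rintro (x | z) hz
        · exact absurd ⟨x.1, rfl⟩ hz
        · exact ⟨z, rfl⟩
      · rw [← hc]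
        exact Finset.card_filter_le _ _
    · unfold ADTNetwork.mincut
      refine le_iInf fun Ω' => ?_
      rw [Nat.cast_le]
      exact (le_cutRank_iff_le_sinkCut N hl hnb).2 h Ω'.1 Ω'.2.1 Ω'.2.2

end LayeredNetwork

/-! ### Feeding, exchanging and finding regular sets -/

namespace LayeredNetwork

variable {V : Type*} [Fintype V] {n : ℕ} {F : Type*} [Field F]

lemma isRegular_map_inl_iff (N : LayeredNetwork V n) {W : Finset (InPort V n)} {l R : ℕ}
    (hl : ∀ x ∈ W, N.layer x.1 = l) :
    N.IsRegular F R (W.map Function.Embedding.inl) ↔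
      W.card = R ∧ R ≤ N.capacity F l (W.map Function.Embedding.inl) := by
  rw [isRegular_iff N (l := l), Finset.card_map]
  · intro p hp
    obtain ⟨x, hx, rfl⟩ := Finset.mem_map.1 hp
    exact hl x hx
  · intro v i j _ hp
    obtain ⟨x, -, h⟩ := Finset.mem_map.1 hp
    cases h

lemma isRegular_map_inr_iff (N : LayeredNetwork V n) {W : Finset (OutPort V n)} {l R : ℕ}
    (hl : ∀ y ∈ W, N.layer y.1 = l) :
    N.IsRegular F R (W.map Function.Embedding.inr) ↔
      W.card = R ∧ R ≤ N.capacity F l (W.map Function.Embedding.inr) := by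
  rw [isRegular_iff N (l := l), Finset.card_map]
  · intro p hp
    obtain ⟨x, hx, rfl⟩ := Finset.mem_map.1 hp
    exact hl x hx
  · intro v i j hp _
    obtain ⟨x, -, h⟩ := Finset.mem_map.1 hp
    cases h

lemma isRankFun_setRank_left {O I : Type*} [DecidableEq O] [Finite O] [Finite I] (M : Matrix O I F)
    (Y : Set I) : IsRankFun fun X : Finset O => setRank M (X : Set O) Y where
  mono A e := setRank_mono M (by simp) subset_rfl
  unit A e := by
    rw [Finset.insert_eq, Finset.coe_union, Set.union_comm]
    refine (setRank_union_left_le M _ _ _).trans (Nat.add_le_add_left ?_ _)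
    simpa using setRank_le_ncard_left M ((({e} : Finset O) : Set O)) Y
  submod A B := by
    have := setRank_submodular M (A : Set O) B Y Y
    rw [Finset.coe_union, Finset.coe_inter]
    rwa [Set.inter_self, Set.union_self] at this

lemma _root_.IsRankFun.map {α β : Type*} [DecidableEq α] [DecidableEq β] {f : Finset β → ℕ}
    (hf : IsRankFun f) (e : α ↪ β) : IsRankFun fun A => f (A.map e) where
  mono A a := by simp only [Finset.map_insert]; exact hf.mono _ _
  unit A a := by simp only [Finset.map_insert]; exact hf.unit _ _
  submod A B := by simp only [Finset.map_union, Finset.map_inter]; exact hf.submod _ _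

/-- A regular set of input ports is fed with full rank by a regular set of output ports of the
preceding layer. -/
theorem exists_regular_outputs (N : LayeredNetwork V n) {l R : ℕ} (hl : 1 ≤ l)
    {W' : Finset (InPort V n)} (hW' : ∀ x ∈ W', N.layer x.1 = l + 1)
    (hreg : N.IsRegular F R (W'.map Function.Embedding.inl)) :
    ∃ W : Finset (OutPort V n), (∀ y ∈ W, N.layer y.1 = l) ∧
      N.IsRegular F R (W.map Function.Embedding.inr) ∧
      ((N.toADT.incidence F).submatrix (fun y : {y // y ∈ W} => y.1)
        (fun x : {x // x ∈ W'} => x.1)).rank = R := by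
  classical
  rw [isRegular_map_inl_iff N hW', le_capacity_iff] at hreg
  obtain ⟨hcard, hcap⟩ := hreg
  set M := N.toADT.incidence F
  have hf := isRankFun_setRank_left M (W' : Set (InPort V n))
  have hg := (isRankFun_capacity F N l).map (Function.Embedding.inr : OutPort V n ↪ Port V n)
  have hf0 : setRank M ((∅ : Finset (OutPort V n)) : Set (OutPort V n)) W' = 0 :=
    setRank_eq_zero M (by simp)
  have hg0 : N.capacity F l ((∅ : Finset (OutPort V n)).map Function.Embedding.inr) = 0 := by
    rw [Finset.map_empty]; exact capacity_empty F N l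
  obtain ⟨W, hWE, hWcard, h1, h2⟩ := IsRankFun.exists_common_independent (k := R)
    (Finset.univ.filter fun y : OutPort V n => N.layer y.1 = l) hf hg (by
      intro U hU
      rw [hf0, hg0, add_zero, add_zero]
      set C := (Finset.univ.filter fun y : OutPort V n => N.layer y.1 = l) \ U with hC
      obtain ⟨Ω, hΩ, hΩ'⟩ := exists_layerCut_eq F N l (C.map Function.Embedding.inr)
      rw [← hΩ']
      -- An optimal cut for `C` is glued to layer `l + 1`, which goes entirely to the source side so
      -- that `W'` supplies the only columns there. The columns of earlier layers give the rank term
      -- of the cut for `C`. The rows meeting `W'` lie in `U`, or in `C ∩ Ω`, where they are paid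
      -- for by the count term.
      have h := hcap ({v | v ∈ Ω ∧ N.layer v ≤ l} ∪ {v | N.layer v = l + 1})
        (.inl ⟨hΩ, by rw [N.layer_source]; exact hl⟩)
      set Ω₂ : Set V := {v | v ∈ Ω ∧ N.layer v ≤ l} ∪ {v | N.layer v = l + 1}
      have hz : ((W'.map Function.Embedding.inl).filter fun p => p ∈ N.cutPorts Ω₂) = ∅ := by
        rw [Finset.filter_eq_empty_iff]
        intro p hp hp'
        obtain ⟨x, hx, rfl⟩ := Finset.mem_map.1 hp
        have h3 := hW' x hx
        change x.1 = N.source at hp'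
        rw [hp', N.layer_source] at h3
        omega
      unfold layerCut at h
      rw [hz, Finset.card_empty, add_zero] at h
      set X₁ := N.cutOutputs l Ω
      set Y₁ := N.cutInputs l Ω (C.map Function.Embedding.inr)
      set T : Set (OutPort V n) := {y | y ∈ C ∧ y.1 ∈ Ω}
      have h4 : setRank M (N.cutOutputs (l + 1) Ω₂)
          (N.cutInputs (l + 1) Ω₂ (W'.map Function.Embedding.inl)) ≤
          setRank M (N.cutOutputs (l + 1) Ω₂) (Y₁ ∪ W') := by
        apply setRank_mono _ subset_rfl
        rintro x ⟨hx, hx'⟩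
        by_cases hxW : x ∈ W'
        · exact .inr hxW
        · left
          have hx2 : x.1 ∉ Ω₂ := hx'.resolve_right fun h => hxW (by simpa using h.1)
          have hx3 : N.layer x.1 ≤ l := by
            by_contra hlt
            exact hx2 (.inr (by simp only [Set.mem_ofPred_eq]; omega))
          exact ⟨hx3, .inl fun h => hx2 (.inl ⟨h, hx3⟩)⟩
      have h5 := setRank_union_right_le M (N.cutOutputs (l + 1) Ω₂) Y₁ W'
      have h6 : setRank M (N.cutOutputs (l + 1) Ω₂) Y₁ ≤ setRank M X₁ Y₁ := by
        apply setRank_le_of_rows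
        rintro y ⟨hy, hy'⟩ hy2 x ⟨hx, -⟩
        apply incidence_eq_zero
        intro heq
        apply hy2
        refine ⟨?_, by omega⟩
        rcases hy with hy | hy
        · exact hy.1
        · simp only [Set.mem_ofPred_eq] at hy
          omega
      have h7 : setRank M (N.cutOutputs (l + 1) Ω₂) W' ≤ setRank M (U ∪ T) W' := by
        apply setRank_le_of_rows
        rintro y ⟨hy, hy'⟩ hy2 x hx
        apply incidence_eq_zero
        intro heq
        have h8 := hW' x hx
        apply hy2
        by_cases hyU : y ∈ U
        · exact .inl hyU
        · refine .inr ⟨?_, ?_⟩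
          · rw [hC, Finset.mem_sdiff, Finset.mem_filter]
            exact ⟨⟨Finset.mem_univ _, by omega⟩, hyU⟩
          · rcases hy with hy | hy
            · exact hy.1
            · simp only [Set.mem_ofPred_eq] at hy
              omega
      have h8 := setRank_union_left_le M U T W'
      have h9 := setRank_le_ncard_left M T W'
      have h10 : T.ncard ≤
          ((C.map Function.Embedding.inr).filter fun p => p ∈ N.cutPorts Ω).card := by
        rw [← Set.ncard_image_of_injective T (Sum.inr_injective (α := InPort V n)),
          ← Set.ncard_coe_finset]
        apply Set.ncard_le_ncard _ (Finset.finite_toSet _)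
        rintro _ ⟨y, hy, rfl⟩
        exact Finset.mem_coe.2 (Finset.mem_filter.2
          ⟨Finset.mem_map.2 ⟨y, hy.1, rfl⟩, hy.2⟩)
      change R ≤ setRank M _ _ at h
      change R ≤ _ + (setRank M X₁ Y₁ + _)
      omega)
  have hWl : ∀ y ∈ W, N.layer y.1 = l := fun y hy => (Finset.mem_filter.1 (hWE hy)).2
  refine ⟨W, hWl, ?_, ?_⟩
  · rw [isRegular_map_inr_iff N hWl]
    exact ⟨hWcard, by rw [hg0, add_zero] at h2; exact h2⟩
  · have h3 : setRank M (W : Set (OutPort V n)) W' = R := by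
      apply le_antisymm
      · refine (setRank_le_ncard_left M _ _).trans ?_
        rw [Set.ncard_coe_finset, hWcard]
      · rw [hf0, add_zero] at h1; exact h1
    have : Fintype ↑(W' : Set (InPort V n)) := Fintype.ofFinite _
    rw [← h3, ← setRank_eq_rank]
    congr!

/-- In the first layer, only ports of the source can be regular. -/
lemma IsRegular.node_eq_source {N : LayeredNetwork V n} {R : ℕ} {W : Finset (Port V n)}
    (h : N.IsRegular F R W) (hl : ∀ p ∈ W, N.layer p.node = 1) :
    ∀ p ∈ W, p.node = N.source := by
  classical
  -- No output port precedes layer 1, so the rank term vanishes and the cut `{N.source}` must count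
  -- all of `W`.
  have h1 := le_capacity_iff.1 ((isRegular_iff N hl h.not_both).1 h).2 {N.source} rfl
  unfold layerCut at h1
  rw [setRank_eq_zero] at h1
  · have h2 : (W.filter fun p => p ∈ N.cutPorts {N.source}) = W :=
      Finset.eq_of_subset_of_card_le (Finset.filter_subset _ _) (by
        rw [h.card_eq]; omega)
    intro p hp
    rw [← h2] at hp
    have h3 := (Finset.mem_filter.1 hp).2
    rcases p with x | y <;> exact h3
  · rintro y ⟨-, hy⟩ x -
    have := N.layer_pos y.1
    omega

/-- The upper input ports of the source form a regular set. -/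
lemma isRegular_source (N : LayeredNetwork V n) {R : ℕ} {W : Finset (Port V n)}
    (h : ∀ p ∈ W, ∃ i, p = Sum.inl (N.source, i)) (hcard : W.card = R) : N.IsRegular F R W := by
  classical
  rw [isRegular_iff N (l := 1)]
  · refine ⟨hcard, le_capacity_iff.2 fun Ω hΩ => ?_⟩
    unfold layerCut
    rw [Finset.filter_true_of_mem, hcard]
    · exact Nat.le_add_left _ _
    · intro p hp
      obtain ⟨i, rfl⟩ := h p hp
      exact (rfl : N.source = N.source)
  · intro p hp
    obtain ⟨i, rfl⟩ := h p hp
    exact N.layer_source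
  · intro v i j _ hp
    obtain ⟨i, h'⟩ := h _ hp
    cases h'

open Classical in
/-- The set in which the output ports of `v` in `W` are replaced by the input ports `I` of `v`. -/
noncomputable def exchange (W : Finset (Port V n)) (v : V) (I : Finset (Fin n)) :
    Finset (Port V n) :=
  (W.filter fun p => p.node ≠ v) ∪ I.image fun i => Sum.inl (v, i)

open Classical in
/-- The output ports of `v` in a regular set can be exchanged for as many input ports of `v`. -/
theorem exists_exchange (N : LayeredNetwork V n) {l R : ℕ} {W : Finset (Port V n)} {v : V}
    (hW : N.IsRegular F R W) (hl : ∀ p ∈ W, N.layer p.node = l) (hv : N.layer v = l)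
    (hvW : ∀ i, Sum.inl (v, i) ∉ W) :
    ∃ I : Finset (Fin n), I.card = (Finset.univ.filter fun j : Fin n => Sum.inr (v, j) ∈ W).card ∧
      N.IsRegular F R (exchange W v I) ∧ (v = N.source → ∀ i ∈ I, (i : ℕ) < R) := by
  set J := Finset.univ.filter fun j : Fin n => Sum.inr (v, j) ∈ W with hJ
  set W₀ := W.filter fun p => p.node ≠ v with hW₀
  have hinj : Function.Injective fun i : Fin n => (Sum.inl (v, i) : Port V n) := fun i j h => by
    simpa using h
  have hcardW : W₀.card + J.card = R := by
    have h1 : (W.filter fun p => p.node = v).card = J.card := by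
      rw [card_filter_node_eq, Finset.filter_eq_empty_iff.2 fun i _ => hvW i, Finset.card_empty,
        zero_add]
    have h2 := Finset.card_filter_add_card_filter_not (s := W) fun p => p.node = v
    change _ + W₀.card = _ at h2
    rw [h1, hW.card_eq] at h2
    omega
  have hcardE : ∀ I : Finset (Fin n), (exchange W v I).card = W₀.card + I.card := by
    intro I
    rw [exchange, Finset.card_union_of_disjoint, Finset.card_image_of_injective _ hinj]
    rw [Finset.disjoint_left]
    intro p hp hp'
    obtain ⟨i, -, rfl⟩ := Finset.mem_image.1 hp'
    exact (Finset.mem_filter.1 hp).2 rfl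
  have hlE : ∀ I : Finset (Fin n), ∀ p ∈ exchange W v I, N.layer p.node = l := by
    intro I p hp
    rcases Finset.mem_union.1 hp with hp | hp
    · exact hl p (Finset.mem_filter.1 hp).1
    · obtain ⟨i, -, rfl⟩ := Finset.mem_image.1 hp
      exact hv
  have hnbE : ∀ I : Finset (Fin n), ∀ u i j, Sum.inl (u, i) ∈ exchange W v I →
      Sum.inr (u, j) ∉ exchange W v I := by
    intro I u i j hp hp'
    have h1 : Sum.inr (u, j) ∈ W₀ := (Finset.mem_union.1 hp').resolve_right fun h => by
      obtain ⟨i, -, h⟩ := Finset.mem_image.1 h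
      cases h
    obtain ⟨h1, h2⟩ := Finset.mem_filter.1 h1
    rcases Finset.mem_union.1 hp with hp | hp
    · exact hW.not_both u i j (Finset.mem_filter.1 hp).1 h1
    · obtain ⟨i, -, h⟩ := Finset.mem_image.1 hp
      cases h
      exact h2 rfl
  have hcap := le_capacity_iff.1 ((isRegular_iff N hl hW.not_both).1 hW).2
  by_cases hvS : v = N.source
  · have hl1 : l = 1 := by rw [← hv, hvS, N.layer_source]
    have hall := hW.node_eq_source (hl1 ▸ hl)
    have hW₀e : W₀ = ∅ := Finset.filter_eq_empty_iff.2 fun p hp h => h (hvS ▸ hall p hp)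
    rw [hW₀e, Finset.card_empty, zero_add] at hcardW
    have hRn : R ≤ n := by
      rw [← hcardW]
      exact (Finset.card_filter_le _ _).trans (by simp)
    refine ⟨Finset.univ.filter fun i : Fin n => (i : ℕ) < R, ?_, ?_, fun _ i hi =>
      (Finset.mem_filter.1 hi).2⟩
    · rw [Fin.card_filter_val_lt, hcardW]; omega
    · apply isRegular_source
      · intro p hp
        rw [exchange, ← hW₀, hW₀e, Finset.empty_union, hvS] at hp
        obtain ⟨i, -, rfl⟩ := Finset.mem_image.1 hp
        exact ⟨i, rfl⟩
      · rw [hcardE, hW₀e, Finset.card_empty, zero_add, Fin.card_filter_val_lt]; omega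
  · have hrank := ((isRankFun_capacity F N l).union_left W₀).map ⟨_, hinj⟩
    -- With `hup`, this pins the capacity of `W₀` to `R - J.card`, so the extension to value `R`
    -- uses exactly `J.card` inputs. Adding `v` to the cut charges at most the outputs in `J`.
    have hlow : R - J.card ≤ N.capacity F l (W₀ ∪ (∅ : Finset (Fin n)).map ⟨_, hinj⟩) := by
      rw [Finset.map_empty, Finset.union_empty, le_capacity_iff]
      intro Ω hΩ
      have h1 := hcap (insert v Ω) (.inr hΩ)
      have h2 : setRank (N.toADT.incidence F) (N.cutOutputs l (insert v Ω))
          (N.cutInputs l (insert v Ω) W) ≤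
          setRank (N.toADT.incidence F) (N.cutOutputs l Ω) (N.cutInputs l Ω W₀) := by
        apply setRank_mono
        · rintro y ⟨rfl | hy, hy'⟩
          · omega
          · exact ⟨hy, hy'⟩
        · rintro x ⟨hx, h⟩
          refine ⟨hx, h.imp (fun h h' => h (.inr h')) fun h => ⟨?_, h.2⟩⟩
          refine Finset.mem_filter.2 ⟨h.1, ?_⟩
          intro hxv
          change x.1 = v at hxv
          exact hvW x.2 (hxv ▸ h.1)
      have h3 : (W.filter fun p => p ∈ N.cutPorts (insert v Ω)).card ≤
          J.card + (W₀.filter fun p => p ∈ N.cutPorts Ω).card := by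
        have hinr : Function.Injective fun i : Fin n => (Sum.inr (v, i) : Port V n) :=
          fun i j h => by simpa using h
        rw [← Finset.card_image_of_injective J hinr]
        refine (Finset.card_le_card ?_).trans (Finset.card_union_le _ _)
        intro p hp
        obtain ⟨h4, h5⟩ := Finset.mem_filter.1 hp
        rw [Finset.mem_union, Finset.mem_image, Finset.mem_filter, hW₀, Finset.mem_filter]
        by_cases hpv : p.node = v
        · left
          rcases p with ⟨u, i⟩ | ⟨u, j⟩
          · cases hpv
            exact absurd h4 (hvW i)
          · cases hpv
            exact ⟨j, Finset.mem_filter.2 ⟨Finset.mem_univ _, h4⟩, rfl⟩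
        · refine .inr ⟨⟨h4, hpv⟩, ?_⟩
          rcases p with x | y
          · exact h5
          · exact h5.resolve_left hpv
      unfold layerCut at h1 ⊢
      omega
    -- Taking all inputs of `v` is at least as good as taking its outputs: it has the effect of
    -- moving `v` behind the cut.
    have hhigh : R ≤ N.capacity F l (W₀ ∪ (Finset.univ : Finset (Fin n)).map ⟨_, hinj⟩) := by
      rw [le_capacity_iff]
      intro Ω hΩ
      refine (hcap (Ω \ {v}) ⟨hΩ, fun h => hvS h.symm⟩).trans
        (add_le_add (setRank_mono _ ?_ ?_) (Finset.card_le_card ?_))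
      · rintro y ⟨hy, hy'⟩
        exact ⟨hy.1, hy'⟩
      · rintro x ⟨hx, h⟩
        refine ⟨hx, ?_⟩
        by_cases hxv : x.1 = v
        · refine .inr ⟨Finset.mem_union_right _ (Finset.mem_map.2 ⟨x.2, Finset.mem_univ _, ?_⟩),
            fun h => hvS (hxv.symm.trans h)⟩
          subst hxv; rfl
        · exact h.imp (fun h h' => h ⟨h', hxv⟩) fun h =>
            ⟨Finset.mem_union_left _ (Finset.mem_filter.2 ⟨h.1, hxv⟩), h.2⟩
      · intro p hp
        obtain ⟨h4, h5⟩ := Finset.mem_filter.1 hp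
        have hpv : p.node ≠ v := by
          rcases p with x | y
          · exact fun h => hvS (h.symm.trans h5)
          · exact fun h => h5.2 h
        refine Finset.mem_filter.2 ⟨Finset.mem_union_left _ (Finset.mem_filter.2 ⟨h4, hpv⟩), ?_⟩
        rcases p with x | y
        · exact h5
        · exact h5.1
    have hup : N.capacity F l (W₀ ∪ (∅ : Finset (Fin n)).map ⟨_, hinj⟩) ≤ W₀.card := by
      rw [Finset.map_empty, Finset.union_empty]
      have := le_capacity_iff.1 (le_refl (N.capacity F l W₀)) Set.univ (Set.mem_univ _)
      unfold layerCut at this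
      have hz : setRank (N.toADT.incidence F) (N.cutOutputs l Set.univ)
          (N.cutInputs l Set.univ W₀) ≤ (W₀.filter fun p => p ∉ N.cutPorts Set.univ).card := by
        refine (setRank_le_ncard_right _ _ _).trans ?_
        rw [← Set.ncard_image_of_injective _ (Sum.inl_injective (β := OutPort V n)),
          ← Set.ncard_coe_finset]
        apply Set.ncard_le_ncard _ (Finset.finite_toSet _)
        rintro _ ⟨x, ⟨-, hx⟩, rfl⟩
        obtain ⟨hx1, hx2⟩ := hx.resolve_left fun h => h (Set.mem_univ _)
        exact Finset.mem_coe.2 (Finset.mem_filter.2 ⟨hx1, hx2⟩)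
      have hs := Finset.card_filter_add_card_filter_not (s := W₀) fun p => p ∈ N.cutPorts Set.univ
      omega
    obtain ⟨I, -, hI, hIc⟩ := hrank.exists_subset_card Finset.univ (k := R)
      (hup.trans (by omega)) hhigh
    have hIcard : I.card = J.card := by omega
    refine ⟨I, hIcard, ?_, fun h => absurd h hvS⟩
    rw [isRegular_iff N (hlE I) (hnbE I), hcardE, hIcard]
    refine ⟨hcardW, ?_⟩
    rw [Finset.map_eq_image] at hI
    exact hI.ge

/-- A supernode that can be reached with rate `R` has a regular set of `R` input ports. -/
theorem exists_regular_inputs (N : LayeredNetwork V n) {R : ℕ} {v : V} (hv : v ≠ N.source)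
    (h : (R : ℕ∞) ≤ N.toADT.mincut F N.source v) :
    ∃ W : Finset (InPort V n), (∀ x ∈ W, x.1 = v) ∧
      N.IsRegular F R (W.map Function.Embedding.inl) := by
  classical
  have hf := (isRankFun_capacity F N (N.layer v)).map
    (Function.Embedding.inl : InPort V n ↪ Port V n)
  have h0 : N.capacity F (N.layer v) ((∅ : Finset (InPort V n)).map Function.Embedding.inl) = 0 := by
    rw [Finset.map_empty]; exact capacity_empty F N _
  obtain ⟨W, hW, h1, h2⟩ := hf.exists_subset_card
    (Finset.univ.filter fun x : InPort V n => x.1 = v) (k := R) (by rw [h0]; exact Nat.zero_le _) (by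
      rw [le_capacity_iff]
      intro Ω hΩ
      unfold ADTNetwork.mincut at h
      -- Behind this cut lie only `v` and supernodes of earlier layers outside `Ω`, so its rank is
      -- at most the rank term for all inputs of `v`.
      have h3 := le_iInf_iff.1 h ⟨(Ω ∪ {u | N.layer v ≤ N.layer u}) \ {v},
        ⟨.inl hΩ, fun hh => hv hh.symm⟩, fun hh => hh.2 rfl⟩
      rw [Nat.cast_le] at h3
      set Ω₂ : Set V := (Ω ∪ {u | N.layer v ≤ N.layer u}) \ {v}
      have h4 : N.toADT.cutRank F Ω₂ = setRank (N.toADT.incidence F)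
          {y | y.1 ∈ Ω₂} {x | x.1 ∉ Ω₂} := by
        have : Fintype ↑{x : InPort V n | x.1 ∉ Ω₂} := Fintype.ofFinite _
        unfold ADTNetwork.cutRank
        rw [← setRank_eq_rank]
        congr!
      rw [h4] at h3
      refine (h3.trans ((setRank_mono _ subset_rfl ?_).trans (setRank_le_of_rows _ ?_))).trans
        (Nat.le_add_right _ _)
      · intro x hx
        by_cases hxv : x.1 = v
        · exact ⟨hxv ▸ le_rfl, .inr ⟨Finset.mem_map.2
            ⟨x, Finset.mem_filter.2 ⟨Finset.mem_univ _, hxv⟩, rfl⟩, fun hh => hv (hxv ▸ hh)⟩⟩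
        · refine ⟨?_, .inl fun hh => hx ⟨.inl hh, hxv⟩⟩
          by_contra hlt
          exact hx ⟨.inr (not_le.1 hlt).le, hxv⟩
      · rintro y ⟨hy, hyv⟩ hy2 x ⟨hx, -⟩
        apply incidence_eq_zero
        intro heq
        apply hy2
        refine ⟨hy.resolve_right fun hh : N.layer v ≤ N.layer y.1 => ?_, ?_⟩ <;> omega)
  rw [h0, add_zero] at h2
  have hWv : ∀ x ∈ W, x.1 = v := fun x hx => (Finset.mem_filter.1 (hW hx)).2
  refine ⟨W, hWv, (isRegular_map_inl_iff N (l := N.layer v) fun x hx => by rw [hWv x hx]).2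
    ⟨h2, h1.ge⟩⟩

end LayeredNetwork

/-! ### Simultaneous choice of coefficients over a finite field -/

/-- A function of finitely many variables that is affine in each of them. -/
def MultiAffine {σ F : Type*} [DecidableEq σ] [Field F] (f : (σ → F) → F) : Prop :=
  ∀ z s, ∃ a b, ∀ t, f (Function.update z s t) = a + t * b

/-- A common point where finitely many nonzero multi-affine functions do not vanish. -/
theorem exists_forall_ne_zero_of_multiAffine {σ ι F : Type*} [DecidableEq σ] [Fintype σ] [Field F]
    [Fintype F] (S : Finset ι) {f : ι → (σ → F) → F} (hf : ∀ i ∈ S, MultiAffine (f i))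
    (hne : ∀ i ∈ S, ∃ z, f i z ≠ 0) (hcard : S.card < Fintype.card F) :
    ∃ z, ∀ i ∈ S, f i z ≠ 0 := by
  classical
  -- The variables are fixed one by one. Each function keeps a private completion `w` at which it
  -- does not vanish, so it forbids at most one value of the next variable. The bound therefore does
  -- not depend on the number of variables.
  have key : ∀ T : Finset σ, ∃ z : σ → F, ∀ i ∈ S, ∃ w : σ → F, (∀ a ∈ T, w a = z a) ∧ f i w ≠ 0 := by
    intro T
    induction T using Finset.induction_on with
    | empty =>
      refine ⟨0, fun i hi => ?_⟩
      obtain ⟨w, hw⟩ := hne i hi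
      exact ⟨w, by simp, hw⟩
    | insert a T ha ih =>
      obtain ⟨z, hz⟩ := ih
      choose! w hw hw' using hz
      have hbad : ∀ i ∈ S,
          (Finset.univ.filter fun t => f i (Function.update (w i) a t) = 0).card ≤ 1 := by
        intro i hi
        obtain ⟨c, b, h⟩ := hf i hi (w i) a
        rw [Finset.card_le_one]
        intro t ht t' ht'
        have h1 := (Finset.mem_filter.1 ht).2
        have h2 := (Finset.mem_filter.1 ht').2
        rw [h] at h1 h2
        by_contra hne
        have h3 : (t - t') * b = 0 := by linear_combination h1 - h2
        have hb : b = 0 := (mul_eq_zero.1 h3).resolve_left (sub_ne_zero.2 hne)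
        apply hw' i hi
        rw [← Function.update_eq_self a (w i), h]
        rw [hb] at h1 ⊢
        rw [mul_zero, add_zero] at h1 ⊢
        exact h1
      have hlt : (S.biUnion fun i =>
          Finset.univ.filter fun t => f i (Function.update (w i) a t) = 0).card <
          (Finset.univ : Finset F).card := by
        refine (Finset.card_biUnion_le.trans (Finset.sum_le_card_nsmul S _ 1 hbad)).trans_lt ?_
        rw [smul_eq_mul, mul_one, Finset.card_univ]
        exact hcard
      obtain ⟨t, -, ht⟩ := Finset.exists_mem_notMem_of_card_lt_card hlt
      refine ⟨Function.update z a t, fun i hi => ⟨Function.update (w i) a t, ?_, ?_⟩⟩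
      · intro c hc
        by_cases hca : c = a
        · subst hca; simp
        · rw [Function.update_of_ne hca, Function.update_of_ne hca]
          exact hw i hi c ((Finset.mem_insert.1 hc).resolve_left hca)
      · intro h0
        exact ht (Finset.mem_biUnion.2 ⟨i, hi, Finset.mem_filter.2 ⟨Finset.mem_univ _, h0⟩⟩)
  obtain ⟨z, hz⟩ := key Finset.univ
  refine ⟨z, fun i hi => ?_⟩
  obtain ⟨w, hw, hw'⟩ := hz i hi
  rwa [← funext fun a => hw a (Finset.mem_univ a)]

/-- The determinant is affine along a rank one matrix. -/
lemma exists_det_add_rank_one {R : ℕ} {F : Type*} [Field F] (A : Matrix (Fin R) (Fin R) F)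
    (c u : Fin R → F) :
    ∃ a b, ∀ t : F, (Matrix.of fun r s => A r s + t * c r * u s).det = a + t * b := by
  -- Bordering `A` by a row and a column makes the rank one perturbation a Schur complement, in
  -- which `t` enters only one row.
  let M : Matrix (Unit ⊕ Fin R) (Unit ⊕ Fin R) F :=
    Matrix.fromBlocks 1 0 (Matrix.of fun r _ => c r) A
  let r₀ : Unit ⊕ Fin R → F := Sum.elim (fun _ => 1) 0
  let r₁ : Unit ⊕ Fin R → F := Sum.elim 0 fun s => - u s
  refine ⟨(M.updateRow (Sum.inl ()) r₀).det, (M.updateRow (Sum.inl ()) r₁).det, fun t => ?_⟩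
  have h1 : (Matrix.of fun r s => A r s + t * c r * u s) =
      A - (Matrix.of fun (r : Fin R) (_ : Unit) => c r) *
        (Matrix.of fun (_ : Unit) (s : Fin R) => t * - u s) := by
    ext r s
    simp only [Matrix.of_apply, Matrix.sub_apply, Matrix.mul_apply, Finset.univ_unique,
      Finset.sum_singleton]
    ring
  have h2 : Matrix.fromBlocks 1 (Matrix.of fun (_ : Unit) (s : Fin R) => t * - u s)
      (Matrix.of fun (r : Fin R) (_ : Unit) => c r) A =
      M.updateRow (Sum.inl ()) (r₀ + t • r₁) := by
    ext (r | r) (s | s) <;>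
      simp [M, r₀, r₁, Matrix.updateRow_apply]
  rw [h1, ← Matrix.det_fromBlocks_one₁₁, h2, Matrix.det_updateRow_add, Matrix.det_updateRow_smul]

lemma linearIndependent_iff_det_ne_zero {R : ℕ} {F α : Type*} [Field F] {W : Finset α}
    (e : Fin R ≃ {p // p ∈ W}) (vec : α → Fin R → F) :
    LinearIndependent F (fun p : {p // p ∈ W} => vec p.1) ↔
      (Matrix.of fun r => vec (e r).1).det ≠ 0 := by
  rw [← linearIndependent_equiv e, ← isUnit_iff_ne_zero, ← Matrix.isUnit_iff_isUnit_det,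
    ← Matrix.linearIndependent_rows_iff_isUnit]
  rfl

/-- Coefficients, each of which enters the vectors with a fixed direction, can be chosen such that
many sets of vectors become linearly independent at the same time. -/
theorem exists_forall_linearIndependent {R : ℕ} {σ α F : Type*} [DecidableEq σ] [Fintype σ]
    [Field F] [Fintype F] (S : Finset (Finset α)) (hS : ∀ W ∈ S, W.card = R)
    (hcard : S.card < Fintype.card F) (vec : (σ → F) → α → Fin R → F)
    (hvec : ∀ z s, ∃ (c : α → F) (u : Fin R → F), ∀ t p,
      vec (Function.update z s t) p = vec (Function.update z s 0) p + (t * c p) • u)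
    (hne : ∀ W ∈ S, ∃ z, LinearIndependent F fun p : {p // p ∈ W} => vec z p.1) :
    ∃ z, ∀ W ∈ S, LinearIndependent F fun p : {p // p ∈ W} => vec z p.1 := by
  classical
  have he : ∀ W ∈ S, Nonempty (Fin R ≃ {p // p ∈ W}) := fun W hW =>
    ⟨(Fintype.equivFinOfCardEq (by simp [hS W hW])).symm⟩
  let e : ∀ W : S, Fin R ≃ {p // p ∈ W.1} := fun W => (he W.1 W.2).some
  obtain ⟨z, hz⟩ := exists_forall_ne_zero_of_multiAffine S.attach
    (f := fun W z => (Matrix.of fun r => vec z (e W r).1).det) (fun W _ z s => by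
      obtain ⟨c, u, h⟩ := hvec z s
      obtain ⟨a, b, h'⟩ := exists_det_add_rank_one
        (Matrix.of fun r => vec (Function.update z s 0) (e W r).1) (fun r => c (e W r).1) u
      refine ⟨a, b, fun t => ?_⟩
      rw [← h' t]
      refine congrArg Matrix.det (Matrix.ext fun r i => ?_)
      simp only [Matrix.of_apply]
      rw [h t]
      rfl) (fun W _ => by
      obtain ⟨z, hz⟩ := hne W.1 W.2
      exact ⟨z, (linearIndependent_iff_det_ne_zero (e W) (vec z)).1 hz⟩)
    (by rwa [Finset.card_attach])
  exact ⟨z, fun W hW => (linearIndependent_iff_det_ne_zero (e ⟨W, hW⟩) (vec z)).2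
    (hz ⟨W, hW⟩ (Finset.mem_attach _ _))⟩

/-! ### The two coding steps -/

namespace LayeredNetwork

variable {V : Type*} {n : ℕ}

lemma mem_frontier_of_insert {N : LayeredNetwork V n} {R l : ℕ} {D : Set V} {v : V} {p : Port V n}
    (hp : p ∈ N.frontier R l (insert v D)) (hpv : p.node ≠ v) : p ∈ N.frontier R l D := by
  obtain ⟨h1, h2⟩ := hp
  refine ⟨h1, ?_⟩
  rcases p with x | y
  · exact ⟨fun h => h2.1 (.inr h), h2.2⟩
  · exact h2.resolve_left hpv

variable [Fintype V] {F : Type*} [Field F]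

open Classical in
/-- The regular sets within a set of ports. -/
noncomputable def regularSets (F : Type*) [Field F] (N : LayeredNetwork V n) (R : ℕ)
    (Q : Set (Port V n)) : Finset (Finset (Port V n)) :=
  Finset.univ.filter fun W => (∀ p ∈ W, p ∈ Q) ∧ N.IsRegular F R W

lemma mem_regularSets {N : LayeredNetwork V n} {R : ℕ} {Q : Set (Port V n)}
    {W : Finset (Port V n)} :
    W ∈ N.regularSets F R Q ↔ (∀ p ∈ W, p ∈ Q) ∧ N.IsRegular F R W := by
  simp [regularSets]

/-- `hQ` allows at most one of the two ports with the same supernode and index, so `Q` has at most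
`n * Nlayer` ports. -/
lemma card_regularSets_le (N : LayeredNetwork V n) {R l Nlayer : ℕ}
    (hN : {v | N.layer v = l}.ncard ≤ Nlayer) {Q : Set (Port V n)}
    (hl : ∀ p ∈ Q, N.layer p.node = l) (hQ : ∀ x, Sum.inl x ∈ Q → Sum.inr x ∉ Q) :
    (N.regularSets F R Q).card ≤ (n * Nlayer).choose R := by
  classical
  have h1 : N.regularSets F R Q ⊆ (Finset.univ.filter fun p => p ∈ Q).powersetCard R := by
    intro W hW
    obtain ⟨h1, h2⟩ := mem_regularSets.1 hW
    exact Finset.mem_powersetCard.2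
      ⟨fun p hp => Finset.mem_filter.2 ⟨Finset.mem_univ _, h1 p hp⟩, h2.card_eq⟩
  refine (Finset.card_le_card h1).trans ?_
  rw [Finset.card_powersetCard]
  apply Nat.choose_le_choose
  have h2 : (Finset.univ.filter fun p => p ∈ Q).card ≤
      ((Finset.univ.filter fun v => N.layer v = l) ×ˢ (Finset.univ : Finset (Fin n))).card := by
    apply Finset.card_le_card_of_injOn (Sum.elim id id)
    · intro p hp
      have := hl p (Finset.mem_filter.1 (Finset.mem_coe.1 hp)).2
      refine Finset.mem_coe.2 (Finset.mem_product.2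
        ⟨Finset.mem_filter.2 ⟨Finset.mem_univ _, ?_⟩, Finset.mem_univ _⟩)
      rcases p with x | y <;> exact this
    · intro p hp p' hp' h
      have h3 := (Finset.mem_filter.1 (Finset.mem_coe.1 hp)).2
      have h4 := (Finset.mem_filter.1 (Finset.mem_coe.1 hp')).2
      rcases p with x | y <;> rcases p' with x' | y' <;> simp only [Sum.elim_inl, Sum.elim_inr, id] at h
      · rw [h]
      · subst h; exact absurd h4 (hQ _ h3)
      · subst h; exact absurd h3 (hQ _ h4)
      · rw [h]
  refine h2.trans ?_
  rw [Finset.card_product, Finset.card_univ, Fintype.card_fin, mul_comm]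
  apply Nat.mul_le_mul_left
  refine le_trans (le_of_eq ?_) hN
  rw [← Set.ncard_coe_finset]
  congr 1
  ext v; simp

/-- The coding step for the input ports of a layer. -/
theorem exists_virtual_coefficients [Fintype F] (N : LayeredNetwork V n) {R l Nlayer : ℕ}
    (hN : {v | N.layer v = l + 1}.ncard ≤ Nlayer) (hq : (n * Nlayer).choose R < Fintype.card F)
    (hl : 1 ≤ l) (x : InPort V n → Fin R → F) (y : OutPort V n → Fin R → F)
    (hinv : N.Invariant R (N.linkedOutputs l) x y) :
    ∃ k : OutPort V n → F, N.Invariant R (N.layerInputs (l + 1)) (N.received k y) y := by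
  classical
  obtain ⟨k, hk⟩ := exists_forall_linearIndependent
    (N.regularSets F R (N.layerInputs (l + 1))) (fun W hW => (mem_regularSets.1 hW).2.card_eq)
    ((card_regularSets_le N hN (by rintro _ ⟨x, hx, rfl⟩; exact hx)
      (by rintro x - ⟨x', -, h⟩; cases h)).trans_lt hq)
    (fun k : OutPort V n → F => Sum.elim (N.received k y) y) (by
      intro k y₀
      -- The coefficient of `y₀` affects several input ports at once, but always in the direction `y
      -- y₀`.
      refine ⟨Sum.elim (fun x => if N.link y₀ x then 1 else 0) 0, y y₀, fun t p => ?_⟩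
      rcases p with x | y'
      · simp only [Sum.elim_inl, received]
        by_cases hlink : N.link y₀ x
        · have hmem : y₀ ∈ Finset.univ.filter fun y' : OutPort V n => N.link y' x := by
            simpa using hlink
          rw [if_pos hlink, ← Finset.add_sum_erase _ _ hmem, ← Finset.add_sum_erase _ _ hmem,
            Function.update_self, Function.update_self, zero_smul, zero_add, mul_one, add_comm]
          congr 1
          refine Finset.sum_congr rfl fun y' hy' => ?_
          rw [Function.update_of_ne (Finset.ne_of_mem_erase hy'),
            Function.update_of_ne (Finset.ne_of_mem_erase hy')]
        · rw [if_neg hlink, mul_zero, zero_smul, add_zero]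
          refine Finset.sum_congr rfl fun y' hy' => ?_
          have hne : y' ≠ y₀ := by
            rintro rfl
            exact hlink (Finset.mem_filter.1 hy').2
          rw [Function.update_of_ne hne, Function.update_of_ne hne]
      · simp) (by
      intro W' hW'
      obtain ⟨hW'l, hreg⟩ := mem_regularSets.1 hW'
      obtain ⟨Wi, rfl⟩ : ∃ Wi : Finset (InPort V n), W' = Wi.map Function.Embedding.inl := by
        refine ⟨Finset.univ.filter fun x => Sum.inl x ∈ W', ?_⟩
        ext p
        constructor
        · intro hp
          obtain ⟨x, -, rfl⟩ := hW'l p hp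
          exact Finset.mem_map.2 ⟨x, by simpa using hp, rfl⟩
        · intro hp
          obtain ⟨x, hx, rfl⟩ := Finset.mem_map.1 hp
          exact (Finset.mem_filter.1 hx).2
      have hWi : ∀ x ∈ Wi, N.layer x.1 = l + 1 := by
        intro x hx
        obtain ⟨x', hx', h⟩ := hW'l _ (Finset.mem_map_of_mem _ hx)
        cases h
        exact hx'
      obtain ⟨W, hWl, hWreg, hrank⟩ := exists_regular_outputs N hl hWi hreg
      have hcWi : Wi.card = R := by rw [← hreg.card_eq, Finset.card_map]
      have hcW : W.card = R := by rw [← hWreg.card_eq, Finset.card_map]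
      let e : Fin R ≃ {y // y ∈ W} := (Fintype.equivFinOfCardEq (by simp [hcW])).symm
      let e' : Fin R ≃ {x // x ∈ Wi} := (Fintype.equivFinOfCardEq (by simp [hcWi])).symm
      let A : Matrix (Fin R) (Fin R) F :=
        (N.toADT.incidence F).submatrix (fun r => (e r).1) fun s => (e' s).1
      have hA : A.det ≠ 0 := by
        have h1 : A.rank = R := by
          refine Eq.trans ?_ hrank
          exact Matrix.rank_submatrix ((N.toADT.incidence F).submatrix
            (fun y : {y // y ∈ W} => y.1) (fun x : {x // x ∈ Wi} => x.1)) e e'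
        rw [← isUnit_iff_ne_zero, ← Matrix.isUnit_iff_isUnit_det,
          ← Matrix.linearIndependent_rows_iff_isUnit,
          linearIndependent_iff_card_eq_finrank_span, Fintype.card_fin]
        rw [Matrix.rank_eq_finrank_span_row] at h1
        exact h1.symm
      -- A port without links would be a zero row of the nonsingular `A`. Hence `W` lies among the
      -- linked ports, where the invariant is assumed.
      have hlinked : ∀ y ∈ W, ∃ x, N.link y x := by
        intro y hy
        by_contra hno
        push Not at hno
        apply hA
        apply Matrix.det_eq_zero_of_row_eq_zero (e.symm ⟨y, hy⟩)
        intro s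
        simp [A, ADTNetwork.incidence, toADT, hno]
      have hli := hinv (W.map Function.Embedding.inr) (by
        intro p hp
        obtain ⟨y, hy, rfl⟩ := Finset.mem_map.1 hp
        exact ⟨y, hWl y hy, hlinked y hy, rfl⟩) hWreg
      have hB : (Matrix.of fun r => y (e r).1).det ≠ 0 := by
        rw [← linearIndependent_iff_det_ne_zero e y]
        exact hli.comp (fun p : {y // y ∈ W} =>
          (⟨Sum.inr p.1, Finset.mem_map_of_mem _ p.2⟩ : {p // p ∈ W.map Function.Embedding.inr}))
          fun p p' h => Subtype.ext (Sum.inr_injective (congrArg Subtype.val h))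
      -- Only `W` transmits, so the received vectors form the product of `A.transpose` with the
      -- matrix of vectors on `W`.
      refine ⟨fun y' => if y' ∈ W then 1 else 0, ?_⟩
      let e'' : Fin R ≃ {p : Port V n // p ∈ Wi.map Function.Embedding.inl} :=
        e'.trans (Equiv.ofBijective
          (fun x => ⟨Sum.inl x.1, Finset.mem_map_of_mem Function.Embedding.inl x.2⟩)
          ⟨fun x x' h => Subtype.ext (Sum.inl_injective (congrArg Subtype.val h)),
            fun ⟨p, hp⟩ => by
              obtain ⟨x, hx, rfl⟩ := Finset.mem_map.1 hp
              exact ⟨⟨x, hx⟩, rfl⟩⟩)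
      rw [linearIndependent_iff_det_ne_zero e'']
      have hmul : (Matrix.of fun s => Sum.elim
          (N.received (fun y' => if y' ∈ W then (1 : F) else 0) y) y (e'' s).1) =
          A.transpose * Matrix.of fun r => y (e r).1 := by
        ext s i
        have he : (e'' s).1 = Sum.inl (e' s).1 := rfl
        simp only [Matrix.of_apply, he, Sum.elim_inl, received, Matrix.mul_apply,
          Matrix.transpose_apply, Finset.sum_apply, Pi.smul_apply, smul_eq_mul, ite_mul, one_mul,
          zero_mul]
        change _ = ∑ r, N.toADT.incidence F (e r).1 (e' s).1 * y (e r).1 i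
        rw [Finset.sum_filter, Equiv.sum_comp e fun w : {y // y ∈ W} =>
          N.toADT.incidence F w.1 (e' s).1 * y w.1 i,
          Finset.sum_coe_sort W fun w => N.toADT.incidence F w (e' s).1 * y w i,
          ← Finset.sum_filter_add_sum_filter_not Finset.univ (fun w => w ∈ W)]
        rw [Finset.sum_eq_zero (s := Finset.univ.filter fun w => ¬ w ∈ W), add_zero,
          Finset.filter_univ_mem]
        · refine Finset.sum_congr rfl fun w hw => ?_
          by_cases hlink : N.link w (e' s).1 <;> simp [hw, hlink, ADTNetwork.incidence, toADT]
        · intro w hw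
          simp [(Finset.mem_filter.1 hw).2]
      rw [hmul, Matrix.det_mul, Matrix.det_transpose]
      exact mul_ne_zero hA hB)
  exact ⟨k, fun W hW hreg => hk W (mem_regularSets.2 ⟨hW, hreg⟩)⟩

/-- The coding step for the output ports of a supernode. -/
theorem exists_internal_coefficients [Fintype F] (N : LayeredNetwork V n) {R l Nlayer : ℕ}
    (hN : {v | N.layer v = l}.ncard ≤ Nlayer) (hq : (n * Nlayer).choose R < Fintype.card F)
    {D : Set V} {v : V} (hv : N.layer v = l) (hvD : v ∉ D)
    (x : InPort V n → Fin R → F) (y : OutPort V n → Fin R → F)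
    (hinv : N.Invariant R (N.frontier R l D) x y) :
    ∃ b : Fin n → Fin n → F, N.Invariant R (N.frontier R l (insert v D)) x (recode v b x y) := by
  classical
  obtain ⟨z, hz⟩ := exists_forall_linearIndependent
    (N.regularSets F R (N.frontier R l (insert v D)))
    (fun W hW => (mem_regularSets.1 hW).2.card_eq)
    ((card_regularSets_le N hN (fun p hp => hp.1) (fun p h h' => h.2.1 h'.2)).trans_lt hq)
    (fun z : Fin n × Fin n → F => Sum.elim x (recode v (fun i j => z (i, j)) x y)) (by
      rintro z ⟨i, j⟩
      refine ⟨Sum.elim 0 fun p => if p = (v, j) then 1 else 0, x (v, i), fun t p => ?_⟩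
      rcases p with p | ⟨u, j'⟩
      · simp
      · simp only [Sum.elim_inr, recode, Prod.mk.injEq]
        by_cases hu : u = v
        · subst hu
          simp only [if_true, true_and]
          by_cases hj : j' = j
          · subst hj
            rw [if_pos rfl, mul_one, ← Finset.add_sum_erase _ _ (Finset.mem_univ i),
              ← Finset.add_sum_erase _ _ (Finset.mem_univ i), Function.update_self,
              Function.update_self, zero_smul, zero_add, add_comm]
            congr 1
            refine Finset.sum_congr rfl fun i' hi' => ?_
            have hne : (i', j') ≠ (i, j') := fun h =>
              Finset.ne_of_mem_erase hi' (congrArg Prod.fst h)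
            rw [Function.update_of_ne hne, Function.update_of_ne hne]
          · rw [if_neg hj, mul_zero, zero_smul, add_zero]
            refine Finset.sum_congr rfl fun i' _ => ?_
            have hne : (i', j') ≠ (i, j) := fun h => hj (congrArg Prod.snd h)
            rw [Function.update_of_ne hne, Function.update_of_ne hne]
        · simp [hu]) (by
      intro W hW
      obtain ⟨hWQ, hreg⟩ := mem_regularSets.1 hW
      have hvW : ∀ i, Sum.inl (v, i) ∉ W := fun i h => (hWQ _ h).2.1 (.inl rfl)
      obtain ⟨I, hIcard, hIreg, hIR⟩ := exists_exchange N hreg (fun p hp => (hWQ p hp).1) hv hvW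
      have hli := hinv _ (by
        intro p hp
        rcases Finset.mem_union.1 hp with hp | hp
        · obtain ⟨h1, h2⟩ := Finset.mem_filter.1 hp
          exact mem_frontier_of_insert (hWQ p h1) h2
        · obtain ⟨i, hi, rfl⟩ := Finset.mem_image.1 hp
          exact ⟨hv, hvD, fun h => hIR h i hi⟩) hIreg
      set J := Finset.univ.filter fun j : Fin n => Sum.inr (v, j) ∈ W
      let e : J ≃ I := Finset.equivOfCardEq hIcard.symm
      -- The value of `g` outside `J` is immaterial: those output ports of `v` are not in `W`.
      let g : Fin n → Fin n := fun j => if h : j ∈ J then (e ⟨j, h⟩).1 else j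
      have hJ : ∀ j, Sum.inr (v, j) ∈ W → j ∈ J := fun j h =>
        Finset.mem_filter.2 ⟨Finset.mem_univ _, h⟩
      have hgI : ∀ j ∈ J, g j ∈ I := by
        intro j hj
        simp only [g, dif_pos hj]
        exact (e ⟨j, hj⟩).2
      have hginj : ∀ j ∈ J, ∀ j' ∈ J, g j = g j' → j = j' := by
        intro j hj j' hj' h
        simp only [g, dif_pos hj, dif_pos hj'] at h
        exact congrArg Subtype.val (e.injective (Subtype.ext h))
      -- Output `j` copies input `g j`, so the vectors on `W` are a relabelling of vectors on the
      -- exchanged set, which lies in the previous frontier.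
      refine ⟨fun q => if q.1 = g q.2 then 1 else 0, ?_⟩
      let φ : Port V n → Port V n := fun p =>
        if p.node = v then Sum.elim (fun q => Sum.inl q) (fun q => Sum.inl (v, g q.2)) p else p
      have hφ : ∀ p ∈ W, φ p ∈ exchange W v I := by
        intro p hp
        by_cases hpv : p.node = v
        · rcases p with ⟨u, i⟩ | ⟨u, j⟩
          · cases hpv
            exact absurd hp (hvW i)
          · cases hpv
            simp only [φ, Port.node, Sum.elim_inr, if_true]
            exact Finset.mem_union_right _
              (Finset.mem_image.2 ⟨g j, hgI j (hJ j hp), rfl⟩)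
        · simp only [φ, if_neg hpv]
          exact Finset.mem_union_left _ (Finset.mem_filter.2 ⟨hp, hpv⟩)
      have hφinj : ∀ p ∈ W, ∀ p' ∈ W, φ p = φ p' → p = p' := by
        have haux : ∀ p ∈ W, p.node = v → ∃ j ∈ J, p = Sum.inr (v, j) ∧ φ p = Sum.inl (v, g j) := by
          intro p hp hpv
          rcases p with ⟨u, i⟩ | ⟨u, j⟩
          · cases hpv
            exact absurd hp (hvW i)
          · cases hpv
            refine ⟨j, hJ j hp, rfl, ?_⟩
            simp only [φ, Port.node, Sum.elim_inr, if_true]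
        intro p hp p' hp' h
        by_cases hpv : p.node = v <;> by_cases hpv' : p'.node = v
        · obtain ⟨j, hj, rfl, h1⟩ := haux p hp hpv
          obtain ⟨j', hj', rfl, h2⟩ := haux p' hp' hpv'
          rw [h1, h2] at h
          simp only [Sum.inl.injEq, Prod.mk.injEq, true_and] at h
          rw [hginj j hj j' hj' h]
        · obtain ⟨j, hj, -, h1⟩ := haux p hp hpv
          have h2 : φ p' = p' := if_neg hpv'
          rw [h1, h2] at h
          exact absurd (by rw [← h]; rfl) hpv'
        · obtain ⟨j, hj, -, h1⟩ := haux p' hp' hpv'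
          have h2 : φ p = p := if_neg hpv
          rw [h1, h2] at h
          exact absurd (by rw [h]; rfl) hpv
        · have h1 : φ p = p := if_neg hpv
          have h2 : φ p' = p' := if_neg hpv'
          rwa [h1, h2] at h
      have hcomp := hli.comp (fun p : {p // p ∈ W} => ⟨φ p.1, hφ p.1 p.2⟩)
        fun p p' h => Subtype.ext (hφinj _ p.2 _ p'.2 (congrArg Subtype.val h))
      convert hcomp using 1
      funext ⟨p, hp⟩
      by_cases hpv : p.node = v
      · rcases p with ⟨u, i⟩ | ⟨u, j⟩
        · cases hpv
          exact absurd hp (hvW i)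
        · cases hpv
          simp [φ, Port.node, recode]
      · simp only [Function.comp_apply, φ, if_neg hpv]
        rcases p with q | q
        · rfl
        · exact if_neg hpv)
  exact ⟨_, fun W hW hreg => hz W (mem_regularSets.2 ⟨hW, hreg⟩)⟩

end LayeredNetwork

/-! ### Building the code layer by layer -/

namespace LayeredNetwork

section Congruence

variable {V : Type*} [Fintype V] {n R : ℕ} {F : Type*} [Field F]

/-- The invariant sees only the vectors on its set of ports, so later choices of coefficients cannot
spoil earlier frontiers. -/
lemma Invariant.congr {N : LayeredNetwork V n} {Q Q' : Set (Port V n)}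
    {x x' : InPort V n → Fin R → F} {y y' : OutPort V n → Fin R → F} (h : N.Invariant R Q x y)
    (hQ : Q' ⊆ Q) (heq : ∀ p ∈ Q', Sum.elim x' y' p = Sum.elim x y p) :
    N.Invariant R Q' x' y' := by
  intro W hW hreg
  convert h W (fun p hp => hQ (hW p hp)) hreg using 1
  funext p
  exact heq p.1 (hW p.1 p.2)

lemma received_congr {M : Type*} [AddCommGroup M] [Module F M] {N : LayeredNetwork V n}
    {k k' : OutPort V n → F} {y y' : OutPort V n → M} {x : InPort V n}
    (h : ∀ p, N.link p x → k p = k' p ∧ y p = y' p) : N.received k y x = N.received k' y' x := by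
  classical
  refine Finset.sum_congr rfl fun p hp => ?_
  obtain ⟨h1, h2⟩ := h p (Finset.mem_filter.1 hp).2
  rw [h1, h2]

/-- Regular sets in layer 1 consist of ports of the source; here these are upper inputs, which carry
distinct standard basis vectors. -/
lemma invariant_source (N : LayeredNetwork V n) (x : InPort V n → Fin R → F)
    (y : OutPort V n → Fin R → F)
    (hx : ∀ i, x (N.source, i) = sourceInput n (fun r => Pi.single r (1 : F)) i) :
    N.Invariant R (N.frontier R 1 ∅) x y := by
  intro W hW hreg
  have hnode := hreg.node_eq_source fun p hp => (hW p hp).1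
  have hp : ∀ p : {p // p ∈ W}, ∃ i : Fin n, p.1 = Sum.inl (N.source, i) ∧ (i : ℕ) < R := by
    rintro ⟨⟨u, i⟩ | ⟨u, j⟩, hp⟩
    · have h1 : u = N.source := hnode _ hp
      subst h1
      exact ⟨i, rfl, (hW _ hp).2.2 rfl⟩
    · exact absurd (hW _ hp).2 (Set.notMem_empty _)
  choose i hi hiR using hp
  have hcomp := (Pi.linearIndependent_single_one (Fin R) F).comp (fun p => ⟨i p, hiR p⟩)
    fun p p' h => Subtype.ext (by rw [hi p, hi p', Fin.ext (Fin.mk.inj_iff.1 h)])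
  convert hcomp using 1
  funext p
  rw [hi p, Sum.elim_inl, hx, sourceInput, dif_pos (hiR p)]
  rfl

end Congruence

variable {V : Type*} [Fintype V] {n R : ℕ} {F : Type*} [Field F]

/-- The initial segments of a layer. -/
def IsInitialSegment [LinearOrder V] (N : LayeredNetwork V n) (l : ℕ) (D : Set V) : Prop :=
  (∀ v ∈ D, N.layer v = l) ∧ ∀ v ∈ D, ∀ w, N.layer w = l → w ≤ v → w ∈ D

/-- The output ports of the symbols that result from the internal coefficients `β`. -/
def encode {M : Type*} [AddCommGroup M] [Module F M] (β : V → Fin n → Fin n → F)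
    (x : InPort V n → M) : OutPort V n → M :=
  fun p => ∑ i, β p.1 i p.2 • x (p.1, i)

/-- Coding the supernodes of a layer one after the other. -/
theorem exists_layer_code [LinearOrder V] [Fintype F] (N : LayeredNetwork V n) {l Nlayer : ℕ}
    (hN : {v | N.layer v = l}.ncard ≤ Nlayer) (hq : (n * Nlayer).choose R < Fintype.card F)
    (x : InPort V n → Fin R → F) (y : OutPort V n → Fin R → F)
    (hinv : N.Invariant R (N.frontier R l ∅) x y) :
    ∃ β : V → Fin n → Fin n → F, ∀ D, N.IsInitialSegment l D →
      N.Invariant R (N.frontier R l D) x (encode β x) := by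
  classical
  have key : ∀ E : Finset V, N.IsInitialSegment l (E : Set V) →
      ∃ β : V → Fin n → Fin n → F, ∀ D : Set V, D ⊆ E → N.IsInitialSegment l D →
        N.Invariant R (N.frontier R l D) x (encode β x) := by
    intro E
    induction E using Finset.induction_on_max with
    | empty =>
      intro _
      refine ⟨0, fun D hD _ => ?_⟩
      obtain rfl : D = ∅ := by simpa using hD
      refine hinv.congr subset_rfl ?_
      rintro (p | p) hp
      · rfl
      · exact absurd hp.2 (Set.notMem_empty _)
    | insert a s hmax ih =>
      intro hini
      have has : a ∉ s := fun h => lt_irrefl _ (hmax a h)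
      have hal : N.layer a = l := hini.1 a (by simp)
      have hs : N.IsInitialSegment l (s : Set V) := by
        refine ⟨fun v hv => hini.1 v (by simp [Finset.mem_coe.1 hv]), fun v hv w hw hle => ?_⟩
        have h1 := hini.2 v (by simp [Finset.mem_coe.1 hv]) w hw hle
        rw [Finset.coe_insert] at h1
        refine h1.resolve_left ?_
        rintro rfl
        exact absurd (hmax v hv) (not_lt.2 hle)
      obtain ⟨β, hβ⟩ := ih hs
      obtain ⟨b, hb⟩ := exists_internal_coefficients N hN hq hal (by simpa using has) x _
        (hβ s subset_rfl hs)
      have hupd : encode (Function.update β a b) x = recode a b x (encode β x) := by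
        funext p
        unfold recode encode
        by_cases hp : p.1 = a
        · rw [if_pos hp, hp, Function.update_self]
        · rw [if_neg hp, Function.update_of_ne hp]
      refine ⟨Function.update β a b, fun D hD hDi => ?_⟩
      rw [hupd]
      -- An initial segment containing the maximum `a` is all of `insert a s`. One that omits `a`
      -- lies in `s`, and recoding `a` does not touch its frontier.
      by_cases haD : a ∈ D
      · have : D = insert a (s : Set V) := by
          apply Set.Subset.antisymm
          · rwa [Finset.coe_insert] at hD
          · rintro v (rfl | hv)
            · exact haD
            · exact hDi.2 a haD v (hs.1 v hv) (hmax v hv).le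
        rw [this]
        exact hb
      · have hDs : D ⊆ s := fun v hv => by
          have := hD hv
          rw [Finset.coe_insert] at this
          refine this.resolve_left ?_
          rintro rfl
          exact haD hv
        refine (hβ D hDs hDi).congr subset_rfl ?_
        rintro (p | p) hp
        · rfl
        · refine if_neg ?_
          intro h
          exact haD (h ▸ hp.2)
  obtain ⟨β, hβ⟩ := key (Finset.univ.filter fun v => N.layer v = l)
    ⟨fun v hv => by simpa using hv, fun v _ w hw _ => by simpa using hw⟩
  exact ⟨β, fun D hD => hβ D (fun v hv => by simpa using hD.1 v hv) hD⟩

/-- A code for the first `l` layers that satisfies the invariant. -/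
theorem exists_code_upto [LinearOrder V] [Fintype F] (N : LayeredNetwork V n) {Nlayer : ℕ}
    (hN : ∀ l, {v | N.layer v = l}.ncard ≤ Nlayer) (hq : (n * Nlayer).choose R < Fintype.card F)
    (l : ℕ) (hl : 1 ≤ l) :
    ∃ (c : LinearCode V n F) (x : InPort V n → Fin R → F) (y : OutPort V n → Fin R → F),
      (∀ i, x (N.source, i) = sourceInput n (fun r => Pi.single r (1 : F)) i) ∧
      (∀ v, v ≠ N.source → N.layer v ≤ l → ∀ i, x (v, i) = N.received c.k y (v, i)) ∧
      (∀ p : OutPort V n, N.layer p.1 ≤ l → y p = encode c.β x p) ∧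
      ∀ m, 1 ≤ m → m ≤ l → ∀ D, N.IsInitialSegment m D →
        N.Invariant R (N.frontier R m D) x y := by
  classical
  induction l, hl using Nat.le_induction with
  | base =>
    -- All virtual coefficients are 0 at this stage, so every supernode but the source receives 0.
    let x : InPort V n → Fin R → F := fun p =>
      if p.1 = N.source then sourceInput n (fun r => Pi.single r (1 : F)) p.2 else 0
    have hx : ∀ i, x (N.source, i) = sourceInput n (fun r => Pi.single r (1 : F)) i := fun i =>
      if_pos rfl
    obtain ⟨β, hβ⟩ := exists_layer_code N (hN 1) hq x 0 (invariant_source N x 0 hx)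
    refine ⟨⟨β, 0⟩, x, encode β x, hx, fun v hv _ i => ?_, fun p _ => rfl, fun m h1 h2 D hD => ?_⟩
    · rw [show x (v, i) = 0 from if_neg hv]
      simp [received]
    · obtain rfl : m = 1 := le_antisymm h2 h1
      exact hβ D hD
  | succ l hl ih =>
    obtain ⟨c, x, y, hsrc, hin, hout, hinv⟩ := ih
    -- With the whole layer as `D`, the frontier consists of all its output ports, in particular the
    -- linked ones.
    obtain ⟨k, hk⟩ := exists_virtual_coefficients N (hN (l + 1)) hq hl x y
      ((hinv l hl le_rfl {v | N.layer v = l} ⟨fun v hv => hv, fun v _ w hw _ => hw⟩).congr (by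
        rintro _ ⟨p, hp, -, rfl⟩
        exact ⟨hp, hp⟩) fun p _ => rfl)
    let x' : InPort V n → Fin R → F := fun p =>
      if N.layer p.1 = l + 1 then N.received k y p else x p
    have hx'1 : ∀ p, N.layer p.1 = l + 1 → x' p = N.received k y p := fun p hp => if_pos hp
    have hx'2 : ∀ p, N.layer p.1 ≤ l → x' p = x p := fun p hp => if_neg (by omega)
    obtain ⟨β, hβ⟩ := exists_layer_code N (hN (l + 1)) hq x' y (hk.congr (by
        rintro (p | p) hp
        · exact ⟨p, hp.1, rfl⟩
        · exact absurd hp.2 (Set.notMem_empty _)) (by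
        rintro (p | p) hp
        · exact hx'1 p hp.1
        · rfl))
    let y' : OutPort V n → Fin R → F := fun p =>
      if N.layer p.1 = l + 1 then encode β x' p else y p
    have hy'1 : ∀ p, N.layer p.1 = l + 1 → y' p = encode β x' p := fun p hp => if_pos hp
    have hy'2 : ∀ p, N.layer p.1 ≤ l → y' p = y p := fun p hp => if_neg (by omega)
    refine ⟨⟨fun v => if N.layer v = l + 1 then β v else c.β v,
      fun p => if N.layer p.1 = l then k p else c.k p⟩, x', y', fun i => ?_,
      fun v hv hvl i => ?_, fun p hp => ?_, fun m h1 h2 D hD => ?_⟩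
    · rw [hx'2 _ (by rw [N.layer_source]; exact hl), hsrc]
    · rcases Nat.lt_or_ge l (N.layer v) with h | h
      · have hv1 : N.layer v = l + 1 := by omega
        rw [hx'1 _ hv1]
        refine received_congr fun p hp => ?_
        have h3 := N.layer_link p _ hp
        dsimp only at h3
        exact ⟨(if_pos (by omega)).symm, (hy'2 p (by omega)).symm⟩
      · rw [hx'2 _ h, hin v hv h]
        refine received_congr fun p hp => ?_
        have h3 := N.layer_link p _ hp
        dsimp only at h3
        exact ⟨(if_neg (by omega)).symm, (hy'2 p (by omega)).symm⟩
    · rcases Nat.lt_or_ge l (N.layer p.1) with h | h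
      · have hp1 : N.layer p.1 = l + 1 := by omega
        rw [hy'1 _ hp1]
        simp only [encode, if_pos hp1]
      · rw [hy'2 _ h, hout p h]
        unfold encode
        refine Finset.sum_congr rfl fun i _ => ?_
        dsimp only
        rw [if_neg (by omega), hx'2 (p.1, i) h]
    · rcases Nat.lt_or_ge l m with h | h
      · obtain rfl : m = l + 1 := by omega
        refine (hβ D hD).congr subset_rfl ?_
        rintro (p | p) hp
        · rfl
        · exact hy'1 p hp.1
      · refine (hinv m h1 h D hD).congr subset_rfl ?_
        rintro (p | p) hp
        · exact hx'2 p (by rw [show N.layer p.1 = m from hp.1]; exact h)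
        · exact hy'2 p (by rw [show N.layer p.1 = m from hp.1]; exact h)

end LayeredNetwork

/-! ### Decoding -/

namespace LinearCode.Transmits

variable {V : Type*} [Fintype V] {n R : ℕ} {F : Type*} [Field F] {c : LinearCode V n F}
  {N : LayeredNetwork V n}

/-- A code and the source input determine the values on all ports. -/
lemma unique {M : Type*} [AddCommGroup M] [Module F M] {s : Fin n → M}
    {x x' : InPort V n → M} {y y' : OutPort V n → M} (h : c.Transmits N s x y)
    (h' : c.Transmits N s x' y') (v : V) :
    (∀ i, x (v, i) = x' (v, i)) ∧ ∀ j, y (v, j) = y' (v, j) := by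
  induction hm : N.layer v using Nat.strong_induction_on generalizing v with
  | _ m ih =>
    have hx : ∀ i, x (v, i) = x' (v, i) := by
      intro i
      by_cases hv : v = N.source
      · rw [hv, h.source_eq, h'.source_eq]
      · rw [h.input_eq v hv, h'.input_eq v hv]
        refine LayeredNetwork.received_congr fun p hp => ⟨rfl, ?_⟩
        have h3 := N.layer_link p _ hp
        dsimp only at h3
        exact (ih _ (by omega) p.1 rfl).2 p.2
    refine ⟨hx, fun j => ?_⟩
    rw [h.output_eq, h'.output_eq]
    exact Finset.sum_congr rfl fun i _ => by rw [hx i]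

/-- Applied to a linear functional, this turns coding vectors into transmitted symbols. -/
lemma map {M M' : Type*} [AddCommGroup M] [Module F M] [AddCommGroup M'] [Module F M']
    (f : M →ₗ[F] M') {s : Fin n → M} {x : InPort V n → M} {y : OutPort V n → M}
    (h : c.Transmits N s x y) :
    c.Transmits N (fun i => f (s i)) (fun p => f (x p)) fun p => f (y p) where
  source_eq i := by rw [h.source_eq]
  input_eq v hv i := by
    rw [h.input_eq v hv, LayeredNetwork.received, LayeredNetwork.received, map_sum]
    simp only [map_smul]
  output_eq v j := by
    rw [h.output_eq, map_sum]
    simp only [map_smul]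

/-- A supernode whose coding vectors span the whole space can decode. -/
lemma exists_decoder {x : InPort V n → Fin R → F} {y : OutPort V n → Fin R → F}
    (h : c.Transmits N (sourceInput n fun r => Pi.single r (1 : F)) x y) {v : V}
    (hv : Submodule.span F (Set.range fun i => x (v, i)) = ⊤) :
    ∃ ε : Fin R → Fin n → F, ∀ (u : Fin R → F) (sx : InPort V n → F) (sy : OutPort V n → F),
      c.Transmits N (sourceInput n u) sx sy → ∀ r, ∑ i, ε r i * sx (v, i) = u r := by
  have hε : ∀ r : Fin R, ∃ ε : Fin n → F, ∑ i, ε i • x (v, i) = Pi.single r (1 : F) := fun r =>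
    (Submodule.mem_span_range_iff_exists_fun F).1 (hv ▸ Submodule.mem_top)
  choose ε hε using hε
  refine ⟨ε, fun u sx sy hs r => ?_⟩
  -- Pairing with `u`. By uniqueness, the symbol at a port is `f` of its coding vector, so
  -- coefficients that recover a basis vector recover the corresponding datum.
  let f : (Fin R → F) →ₗ[F] F := Fintype.linearCombination F u
  have hf : ∀ r, f (Pi.single r 1) = u r := fun r => by
    simp [f, Fintype.linearCombination_apply_single]
  have h1 := h.map f
  have h2 : (fun i => f (sourceInput n (fun r => Pi.single r (1 : F)) i)) = sourceInput n u := by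
    funext i
    unfold sourceInput
    split_ifs
    · exact hf _
    · exact map_zero f
  rw [h2] at h1
  have h3 := (hs.unique h1 v).1
  rw [← hf r, ← hε r, map_sum]
  refine Finset.sum_congr rfl fun i _ => ?_
  rw [h3, map_smul, smul_eq_mul]

end LinearCode.Transmits

/-! ### Assembly -/

theorem mainTheorem4 {V : Type*} [Fintype V] [LinearOrder V] {F : Type*} [Field F] [Fintype F]
    (n R Nlayer : ℕ) (N : LayeredNetwork V n)
    (hN : ∀ l, {v | N.layer v = l}.ncard ≤ Nlayer) :
    -- every regular set of input ports is fed with full rank by a regular set of output ports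
    (∀ l, 1 ≤ l → l < N.depth → ∀ W' : Finset (InPort V n), (∀ x ∈ W', N.layer x.1 = l + 1) →
      N.IsRegular F R (W'.map Function.Embedding.inl) →
      ∃ W : Finset (OutPort V n), (∀ y ∈ W, N.layer y.1 = l) ∧
        N.IsRegular F R (W.map Function.Embedding.inr) ∧
        ((N.toADT.incidence F).submatrix (fun y : {y // y ∈ W} => y.1)
          (fun x : {x // x ∈ W'} => x.1)).rank = R) ∧
    -- the step for the input ports of a layer
    (2 * (n * Nlayer).choose R < Fintype.card F →
      ∀ l, 1 ≤ l → l < N.depth →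
      ∀ (x : InPort V n → Fin R → F) (y : OutPort V n → Fin R → F),
        N.Invariant R (N.linkedOutputs l) x y →
        ∃ k : OutPort V n → F, N.Invariant R (N.layerInputs (l + 1)) (N.received k y) y) ∧
    -- the step for the output ports of a supernode
    (n * (n * Nlayer).choose R < Fintype.card F →
      ∀ l, 1 ≤ l → l ≤ N.depth → ∀ (D : Set V) (v : V), N.layer v = l → v ∉ D →
      ∀ (x : InPort V n → Fin R → F) (y : OutPort V n → Fin R → F),
        N.Invariant R (N.frontier R l D) x y →
        ∃ b : Fin n → Fin n → F,
          N.Invariant R (N.frontier R l (insert v D)) x (recode v b x y)) ∧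
    -- the resulting multicast code
    (2 * (n * Nlayer).choose R < Fintype.card F → n * (n * Nlayer).choose R < Fintype.card F →
      ∃ (c : LinearCode V n F) (x : InPort V n → Fin R → F) (y : OutPort V n → Fin R → F),
        c.Transmits N (sourceInput n fun r => Pi.single r (1 : F)) x y ∧
        (∀ l, 1 ≤ l → l ≤ N.depth → ∀ D : Set V, (∀ v ∈ D, N.layer v = l) →
          (∀ v ∈ D, ∀ w, N.layer w = l → w ≤ v → w ∈ D) →
          N.Invariant R (N.frontier R l D) x y) ∧
        ∀ v, v ≠ N.source → (R : ℕ∞) ≤ N.toADT.mincut F N.source v →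
          ∃ ε : Fin R → Fin n → F, ∀ (u : Fin R → F) (sx : InPort V n → F) (sy : OutPort V n → F),
            c.Transmits N (sourceInput n u) sx sy →
            ∀ r, ∑ i, ε r i * sx (v, i) = u r) := by
  -- The coding steps need the binomial coefficient to be less than `Fintype.card F`. The bound with
  -- the factor `n` gives this unless `n = 0`, and then the coefficient is at most 1.
  have hone : (n * Nlayer).choose R ≤ n * (n * Nlayer).choose R ∨ (n * Nlayer).choose R ≤ 1 := by
    rcases Nat.eq_zero_or_pos n with rfl | hn
    · right
      rw [Nat.zero_mul]
      rcases R with _ | R <;> simp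
    · exact .inl (Nat.le_mul_of_pos_left _ hn)
  have hF : 1 < Fintype.card F := Fintype.one_lt_card
  refine ⟨fun l hl _ W' hW' hreg => LayeredNetwork.exists_regular_outputs N hl hW' hreg,
    fun hq l hl _ x y hinv => LayeredNetwork.exists_virtual_coefficients N (hN (l + 1))
      (by omega) hl x y hinv,
    fun hq l _ _ D v hv hvD x y hinv => LayeredNetwork.exists_internal_coefficients N (hN l)
      (by omega) hv hvD x y hinv, fun hq _ => ?_⟩
  obtain ⟨c, x, y, hsrc, hin, hout, hinv⟩ := LayeredNetwork.exists_code_upto N hN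
    (by omega : (n * Nlayer).choose R < Fintype.card F) N.depth
    ((N.layer_pos N.source).trans (N.layer_le N.source))
  have htr : c.Transmits N (sourceInput n fun r => Pi.single r (1 : F)) x y :=
    ⟨hsrc, fun v hv i => hin v hv (N.layer_le v) i, fun v j => hout (v, j) (N.layer_le v)⟩
  refine ⟨c, x, y, htr, fun l h1 h2 D hD hD' => hinv l h1 h2 D ⟨hD, hD'⟩, fun v hv hcut => ?_⟩
  obtain ⟨W, hWv, hreg⟩ := LayeredNetwork.exists_regular_inputs N hv hcut
  -- The frontier of the empty segment contains all input ports of `v`, since `v` is not the source.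
  have hli := hinv (N.layer v) (N.layer_pos v) (N.layer_le v) ∅
    ⟨fun u hu => absurd hu (Set.notMem_empty _), fun u hu => absurd hu (Set.notMem_empty _)⟩ _ (by
      intro p hp
      obtain ⟨q, hq, rfl⟩ := Finset.mem_map.1 hp
      have h1 := hWv q hq
      exact ⟨congrArg N.layer h1, Set.notMem_empty _, fun h => absurd (h1.symm.trans h) hv⟩) hreg
  apply htr.exists_decoder
  have hcard := hreg.card_eq
  have hspan := hli.span_eq_top_of_card_eq_finrank' (by
    rw [Fintype.card_coe, hcard, Module.finrank_fintype_fun_eq_card, Fintype.card_fin])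
  rw [eq_top_iff, ← hspan, Submodule.span_le]
  rintro _ ⟨⟨p, hp⟩, rfl⟩
  obtain ⟨q, hq, rfl⟩ := Finset.mem_map.1 hp
  refine Submodule.subset_span ⟨q.2, ?_⟩
  rw [← hWv q hq]
  rfl
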